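/- For a probability measure $p$ on $\mathbb R$ let $\mu_p$ be its mean, $p^{n*}$ its $n$-fold convolution ($p^{0*}=\delta_0$) and $N_p=\sum_{n\ge 0}p^{n*}$ its renewal measure. Let $\mathcal M$ be a family of probability measures on $\mathbb R$ such that $\inf_{p\in\mathcal M}\mu_p>0$ and $\sup_{p\in\mathcal M}\int e^{\tau|x|}\,p(dx)<\infty$ for some $\tau>0$. Suppose that $p=(1-\lambda_p)\Phi_p+\lambda_p\Psi_p$ for each $p\in\mathcal M$, with $\Phi_p,\Psi_p$ probability measures, $\lambda_p\ge 0$ and $\sup_{p\in\mathcal M}\lambda_p<1$, where $\Phi_p$ has a nonnegative density $\phi_p$ such that, for some $T\in(0,\infty)$, every $\phi_p$ is twice continuously differentiable on $\mathbb R$ with compact support contained in $(-T,T)$ and $\sup_{p\in\mathcal M}\int_{-T}^{T}|\phi_p''(x)|\,dx<\infty$. Put $$\bar N_p=\sum_{n\ge 0}\lambda_p^n\Psi_p^{n*},\qquad q_p(x)=(1-\lambda_p)\int\phi_p(x-y)\,(\bar N_p*N_p)(dy),$$ and for $r>0$ $$A_1(r)=\sup_{x>0,\,p\in\mathcal M}e^{rx}|q_p(x)-\mu_p^{-1}|+\sup_{x>0,\,p\in\mathcal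 M}e^{rx}q_p(-x),\qquad A_2(r)=\sup_{x>0,\,p\in\mathcal M}e^{rx}\bar N_p\big((-\infty,-x]\cup[x,\infty)\big).$$ Then $N_p(dx)=q_p(x)\,dx+\bar N_p(dx)$ for all $p \in \mathcal M$, $\sup_{p\in\mathcal M}\bar N_p(\mathbb R)<\infty$, and there is $r_0>0$ such that $A_1(r)<\infty$ and $A_2(r)<\infty$ for all $r\in(0,r_0)$. Moreover, let $\eta>0$ and let $z_p$ $(p\in\mathcal M)$ be Borel functions on $\mathbb R$ such that $L:=\sup_{x\in\mathbb R,\,p\in\mathcal M}e^{\eta|x|}|z_p(x)|<\infty$. Then for each $p\in\mathcal M$ there is exactly one function $Z_p:\mathbb R\to\mathbb R$ such that $$Z_p(x)=z_p(x)+\int_{-\infty}^{\infty}Z_p(x-y)\,p(dy)\qquad\text{for all }x\in\mathbb R,$$ with absolutely convergent integrals, and $\sup_{x\in\mathbb R}e^{-\varepsilon x}|Z_p(x)|<\infty$ for all sufficiently small $\varepsilon>0$; it is Borel measurable. Put $u_p=\mu_p^{-1}\int z_p(x)\,dx$. For every $r>0$ with $A_1(r),A_2(r)<\infty$, with $\alpha=\tfrac12\min(\eta,r)$,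 $$\sup_{x>0,\,p\in\mathcal M}e^{\alpha x}|Z_p(x)-u_p|+\sup_{x<0,\,p\in\mathcal M}e^{\alpha|x|}|Z_p(x)|\le C\big(A_1(r),A_2(r),L,\eta,r\big).$$ Here $C$ is a continuous function on $[0,\infty)^3\times(0,\infty)^2$ that does not depend on $\mathcal M$, the mixtures, the $z_p$, $\eta$ or $r$. -/

import Mathlib

open MeasureTheory Set
open scoped ENNReal

noncomputable section

namespace Renewal

/-- The `n`-fold convolution of a measure on `ℝ`; the `0`-fold one is the Dirac mass at `0`. -/
def convPow (p : Measure ℝ) : ℕ → Measure ℝ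
  | 0 => Measure.dirac 0
  | n + 1 => Measure.conv (convPow p n) p

/-- The renewal measure `N_p = ∑ₙ p^{n*}`. -/
def renewalMeasure (p : Measure ℝ) : Measure ℝ :=
  Measure.sum (convPow p)

/-- The mean `μ_p`. -/
def mean (p : Measure ℝ) : ℝ := ∫ x, x ∂p

/-- The hypotheses on a family of probability measures `p i` on `ℝ` (`i : ι`), written as mixtures
`p i = (1 - lam i) Φ i + lam i Ψ i` in which `Φ i` has the density `φ i`: the means are bounded away
from `0`, some exponential moment is uniformly bounded, the weights `lam i` are bounded away
from `1`, the densities are `C²` with compact support in a common interval `(-T, T)`, and the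
`L¹`-norms of their second derivatives are bounded. -/
structure IsUniformFamily {ι : Type*} (p Φ Ψ : ι → Measure ℝ) (φ : ι → ℝ → ℝ) (lam : ι → ℝ) :
    Prop where
  prob_p : ∀ i, IsProbabilityMeasure (p i)
  prob_Φ : ∀ i, IsProbabilityMeasure (Φ i)
  prob_Ψ : ∀ i, IsProbabilityMeasure (Ψ i)
  mean_pos : ∃ m : ℝ, 0 < m ∧ ∀ i, m ≤ mean (p i)
  exp_moment : ∃ τ : ℝ, 0 < τ ∧ (⨆ i, ∫⁻ x, ENNReal.ofReal (Real.exp (τ * |x|)) ∂(p i)) < ∞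
  mixture : ∀ i, p i = ENNReal.ofReal (1 - lam i) • Φ i + ENNReal.ofReal (lam i) • Ψ i
  lam_nonneg : ∀ i, 0 ≤ lam i
  lam_lt_one : ∃ γ : ℝ, γ < 1 ∧ ∀ i, lam i ≤ γ
  density_nonneg : ∀ i x, 0 ≤ φ i x
  density : ∀ i, Φ i = volume.withDensity (fun x => ENNReal.ofReal (φ i x))
  smooth : ∃ T : ℝ, 0 < T ∧
    (∀ i, ContDiff ℝ 2 (φ i) ∧ HasCompactSupport (φ i) ∧ tsupport (φ i) ⊆ Ioo (-T) T) ∧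
    ∃ B : ℝ, ∀ i, ∫ x in (-T)..T, |iteratedDeriv 2 (φ i) x| ≤ B

/-- The component `N̄ = ∑ₙ lamⁿ Ψ^{n*}` of the renewal measure of `(1 - lam) Φ + lam Ψ`. -/
def finitePart (Ψ : Measure ℝ) (lam : ℝ) : Measure ℝ :=
  Measure.sum fun n : ℕ => ENNReal.ofReal (lam ^ n) • convPow Ψ n

/-- The density `q` of the component `Q = (1 - lam) Φ * N̄ * N_p` of the renewal measure of
`p = (1 - lam) Φ + lam Ψ`, where `φ` is the density of `Φ`. -/
def acDensity (p Ψ : Measure ℝ) (φ : ℝ → ℝ) (lam : ℝ) (x : ℝ) : ℝ :=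
  (1 - lam) * ∫ y, φ (x - y) ∂(Measure.conv (finitePart Ψ lam) (renewalMeasure p))

/-- `A₁ = sup_{x > 0, i} e^{rx} |q_i(x) - μ_i⁻¹| + sup_{x > 0, i} e^{rx} q_i(-x)`. -/
def boundA₁ {ι : Type*} (p Ψ : ι → Measure ℝ) (φ : ι → ℝ → ℝ) (lam : ι → ℝ) (r : ℝ) : ℝ≥0∞ :=
  (⨆ (i : ι) (x : ℝ) (_ : 0 < x), ENNReal.ofReal
      (Real.exp (r * x) * |acDensity (p i) (Ψ i) (φ i) (lam i) x - (mean (p i))⁻¹|)) +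
  ⨆ (i : ι) (x : ℝ) (_ : 0 < x), ENNReal.ofReal
      (Real.exp (r * x) * acDensity (p i) (Ψ i) (φ i) (lam i) (-x))

/-- `A₂ = sup_{x > 0, i} e^{rx} N̄_i((-∞, -x] ∪ [x, ∞))`. -/
def boundA₂ {ι : Type*} (Ψ : ι → Measure ℝ) (lam : ι → ℝ) (r : ℝ) : ℝ≥0∞ :=
  ⨆ (i : ι) (x : ℝ) (_ : 0 < x),
    ENNReal.ofReal (Real.exp (r * x)) * finitePart (Ψ i) (lam i) (Iic (-x) ∪ Ici x)

/-- `L = sup_{x, i} e^{η|x|} |z_i(x)|`. -/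
def boundL {ι : Type*} (z : ι → ℝ → ℝ) (η : ℝ) : ℝ≥0∞ :=
  ⨆ (i : ι) (x : ℝ), ENNReal.ofReal (Real.exp (η * |x|) * |z i x|)

/-- `Z` solves the two-sided renewal equation `Z(x) = z(x) + ∫ Z(x - y) p(dy)`, all the integrals
being absolutely convergent. -/
def IsRenewalSolution (p : Measure ℝ) (z Z : ℝ → ℝ) : Prop :=
  ∀ x, Integrable (fun y => Z (x - y)) p ∧ Z x = z x + ∫ y, Z (x - y) ∂p

/-- `sup_{x ∈ ℝ} e^{-εx} |Z(x)| < ∞` for all sufficiently small `ε > 0`. -/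
def HasSubexpGrowth (Z : ℝ → ℝ) : Prop :=
  ∃ ε₀ : ℝ, 0 < ε₀ ∧ ∀ ε : ℝ, 0 < ε → ε < ε₀ →
    BddAbove (range fun x : ℝ => Real.exp (-ε * x) * |Z x|)

end Renewal

end

/-!
Write `p = a + b` with `a = (1 - lam) • Φ`, `b = lam • Ψ`, and let `M_μ(z) = ∫ e^{zx} μ(dx)` be
`complexMGF id μ z`. Splitting each power `(a + b)^{n*}` at the first factor `a` gives
`N_p = a * N̄ * N_p + N̄` (`renewalMeasure_add`), which is the decomposition into a density `q` and
a finite part.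

*Decay of the density.* For small negative `Re z` the transform of `q` is
`M_a / ((1 - M_b) (1 - M_p))`. Near `0` the function `1 - M_p` behaves like `-(mean p) z`. Away from
`0` on the imaginary axis it is bounded below uniformly over the family: `|M_a|` is small at high
frequencies by two integrations by parts, and the frequency-doubling inequality
`mass_sub_norm_charFun_two_mul_le` brings this down to low ones. A perturbation in `Re z` extends
the bound to a strip (`Admissible.exists_strip`), in which the transform therefore has only a simple
pole at `0`. That pole is cancelled by subtracting from `q` the function
`(mean p)⁻¹ (1 - e^{-x})⁺`; Fourier inversion and a shift of the contour to `Re z = ±r`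
(`abs_le_of_transform`) give exponential decay with uniform constants. The tails of `N̄` are handled
by Markov's inequality.

*The renewal equation.* The solution is `∫ z(x - y) N_p(dy)`, and it is unique because the
convolution operator is a contraction for the supremum norm weighted by `e^{-εx}`, the tilt
`e^{-εx} p(dx)` having mass less than `1`.

*The constant.* The contribution of `q` to the solution is controlled by `A₁` directly, as
`(mean p)⁻¹ ≤ 2 A₁` by continuity of `q` at `0`. For `N̄`, splitting at `|y| = |x| / 2` leaves
the total mass of `N̄` and its tails. The tails, hence `A₂`, do not see the atom of `N̄` at `0`.
That atom is at most `8 A₁ / r` (`Admissible.renewalMeasure_singleton_le`): finiteness of `A₂` gives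
`p` exponential moments of all orders below `r`, so the identity `(1 - M_p) M_N = 1`, where `M_N` is
the transform of `N_p = q dx + N̄`, continues analytically to `0 < z < r`. There `M_p > 1` forces the
continuation of `M_N` to be negative, whereas the atom contributes to it positively.
-/

/-! ### Convolution powers and renewal measures -/

namespace Renewal

open ProbabilityTheory

instance sFinite_convPow (p : Measure ℝ) [SFinite p] : ∀ n, SFinite (convPow p n)
  | 0 => inferInstanceAs (SFinite (Measure.dirac 0))
  | n + 1 =>
    have := sFinite_convPow p n
    inferInstanceAs (SFinite (Measure.conv (convPow p n) p))

instance sFinite_renewalMeasure (p : Measure ℝ) [SFinite p] : SFinite (renewalMeasure p) :=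
  inferInstanceAs (SFinite (Measure.sum (convPow p)))

lemma convPow_smul (c : ℝ≥0∞) (p : Measure ℝ) [SFinite p] (n : ℕ) :
    convPow (c • p) n = c ^ n • convPow p n := by
  induction n with
  | zero => simp [convPow]
  | succ n ih =>
    rw [convPow, ih, Measure.conv_smul_left, Measure.conv_smul_right, smul_smul, ← pow_succ]
    rfl

/-- The finite part of a mixture is the renewal measure of the subprobability measure `lam • Ψ`. -/
lemma finitePart_eq_renewalMeasure (Ψ : Measure ℝ) [SFinite Ψ] {lam : ℝ} (h : 0 ≤ lam) :
    finitePart Ψ lam = renewalMeasure (ENNReal.ofReal lam • Ψ) := by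
  unfold finitePart renewalMeasure
  congr 1
  funext n
  rw [convPow_smul, ENNReal.ofReal_pow h]

lemma sum_conv (μ : ℕ → Measure ℝ) (ν : Measure ℝ) [SFinite ν] :
    Measure.conv (Measure.sum μ) ν = Measure.sum fun n => Measure.conv (μ n) ν := by
  unfold Measure.conv
  rw [Measure.prod_sum_left, Measure.map_sum (by fun_prop)]

lemma conv_sum (μ : Measure ℝ) (ν : ℕ → Measure ℝ) [∀ n, SFinite (ν n)] :
    Measure.conv μ (Measure.sum ν) = Measure.sum fun n => Measure.conv μ (ν n) := by
  unfold Measure.conv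
  rw [Measure.prod_sum_right, Measure.map_sum (by fun_prop)]

lemma sFinite_finset_sum {κ : Type*} (s : Finset κ) (μ : κ → Measure ℝ) [∀ k, SFinite (μ k)] :
    SFinite (∑ k ∈ s, μ k) := by
  rw [← Measure.sum_coe_finset]; infer_instance

lemma finset_sum_conv {κ : Type*} (s : Finset κ) (μ : κ → Measure ℝ) [∀ k, SFinite (μ k)]
    (ν : Measure ℝ) [SFinite ν] :
    Measure.conv (∑ k ∈ s, μ k) ν = ∑ k ∈ s, Measure.conv (μ k) ν := by
  classical
  induction s using Finset.induction_on with
  | empty => simp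
  | insert k s hk ih =>
    have := sFinite_finset_sum s μ
    rw [Finset.sum_insert hk, Finset.sum_insert hk, Measure.add_conv, ih]

lemma tsum_nat_succ (f : ℕ → ℝ≥0∞) : ∑' n, f n = f 0 + ∑' n, f (n + 1) :=
  tsum_eq_zero_add' ENNReal.summable

lemma renewalMeasure_eq_dirac_add (p : Measure ℝ) [SFinite p] :
    renewalMeasure p = Measure.dirac 0 + Measure.conv (renewalMeasure p) p := by
  unfold renewalMeasure
  rw [sum_conv]
  ext s hs
  rw [Measure.sum_apply _ hs, Measure.add_apply, Measure.sum_apply _ hs,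
    tsum_nat_succ]
  simp only [convPow]

/-- Expansion of `(a + b)^{(n+1)*}` by the position of the last factor `b` preceding the first
factor `a`. -/
lemma convPow_add_succ (a b : Measure ℝ) [SFinite a] [SFinite b] (n : ℕ) :
    convPow (a + b) (n + 1) = convPow b (n + 1) +
      ∑ k ∈ Finset.HasAntidiagonal.antidiagonal n,
        Measure.conv a (Measure.conv (convPow b k.1) (convPow (a + b) k.2)) := by
  induction n with
  | zero => simp [convPow, add_comm]
  | succ n ih =>
    have := sFinite_finset_sum (Finset.HasAntidiagonal.antidiagonal n) fun k =>
      Measure.conv a (Measure.conv (convPow b k.1) (convPow (a + b) k.2))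
    rw [convPow, ih, Finset.Nat.sum_antidiagonal_succ', Measure.add_conv, Measure.conv_add,
      finset_sum_conv]
    simp only [Measure.conv_assoc]
    rw [show Measure.conv (convPow b (n + 1)) b = convPow b (n + 1 + 1) from rfl,
      show convPow (a + b) 0 = Measure.dirac 0 from rfl, Measure.conv_dirac_zero,
      Measure.conv_comm (convPow b (n + 1)) a]
    simp only [show ∀ k, Measure.conv (convPow (a + b) k) (a + b) = convPow (a + b) (k + 1)
      from fun _ => rfl]
    rw [add_comm (Measure.conv a (convPow b (n + 1))), add_assoc, add_comm (Measure.conv a _)]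

/-- Splitting the renewal measure of `a + b` at the first factor `a`. -/
lemma renewalMeasure_add (a b : Measure ℝ) [SFinite a] [SFinite b] :
    renewalMeasure (a + b) =
      Measure.conv a (Measure.conv (renewalMeasure b) (renewalMeasure (a + b))) +
        renewalMeasure b := by
  have hR : Measure.conv a (Measure.conv (renewalMeasure b) (renewalMeasure (a + b))) =
      Measure.sum fun i => Measure.sum fun j =>
        Measure.conv a (Measure.conv (convPow b i) (convPow (a + b) j)) := by
    conv_lhs => unfold renewalMeasure
    rw [sum_conv, conv_sum]
    congr 1; funext i
    rw [conv_sum, conv_sum]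
  rw [hR]
  ext s hs
  rw [Measure.add_apply, Measure.sum_apply _ hs]
  simp only [Measure.sum_apply _ hs, renewalMeasure]
  set c : ℕ → ℕ → ℝ≥0∞ := fun i j =>
    Measure.conv a (Measure.conv (convPow b i) (convPow (a + b) j)) s with hc
  have hdiag : ∑' n, ∑ k ∈ Finset.HasAntidiagonal.antidiagonal n, c k.1 k.2 =
      ∑' i, ∑' j, c i j := by
    rw [← ENNReal.tsum_prod (f := c),
      ← Finset.HasAntidiagonal.sigmaAntidiagonalEquivProd.tsum_eq, ENNReal.tsum_sigma']
    refine tsum_congr fun n => ?_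
    rw [tsum_fintype]
    exact (Finset.sum_coe_sort _ fun k : ℕ × ℕ => c k.1 k.2).symm
  have hsucc : ∀ n, convPow (a + b) (n + 1) s = convPow b (n + 1) s +
      ∑ k ∈ Finset.HasAntidiagonal.antidiagonal n, c k.1 k.2 := fun n => by
    rw [convPow_add_succ, Measure.add_apply, Measure.finsetSum_apply]
  have h0 : convPow (a + b) 0 s = convPow b 0 s := by simp only [convPow]
  rw [tsum_nat_succ, tsum_nat_succ fun n => convPow b n s, h0, ← hdiag]
  simp only [hsucc]
  rw [ENNReal.tsum_add]
  ring

lemma lintegral_conv_le (μ ν : Measure ℝ) [SFinite ν] {g : ℝ → ℝ≥0∞} (hg : Measurable g)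
    (hmul : ∀ x y, g (x + y) ≤ g x * g y) :
    ∫⁻ x, g x ∂(Measure.conv μ ν) ≤ (∫⁻ x, g x ∂μ) * ∫⁻ x, g x ∂ν := by
  rw [Measure.lintegral_conv hg]
  calc ∫⁻ x, ∫⁻ y, g (x + y) ∂ν ∂μ ≤ ∫⁻ x, g x * ∫⁻ y, g y ∂ν ∂μ := by
        refine lintegral_mono fun x => ?_
        rw [← lintegral_const_mul _ hg]
        exact lintegral_mono fun y => hmul x y
    _ = _ := lintegral_mul_const _ hg

/-- A submultiplicative weight integrates against `∑ₙ p^{n*}` to at most a geometric series. -/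
lemma lintegral_renewalMeasure_le (p : Measure ℝ) [SFinite p] {g : ℝ → ℝ≥0∞} (hg : Measurable g)
    (hmul : ∀ x y, g (x + y) ≤ g x * g y) (h0 : g 0 ≤ 1) :
    ∫⁻ x, g x ∂(renewalMeasure p) ≤ (1 - ∫⁻ x, g x ∂p)⁻¹ := by
  have h : ∀ n, ∫⁻ x, g x ∂(convPow p n) ≤ (∫⁻ x, g x ∂p) ^ n := fun n => by
    induction n with
    | zero => simpa [convPow] using h0
    | succ n ih =>
      rw [pow_succ]
      exact (lintegral_conv_le _ _ hg hmul).trans (mul_le_mul_left ih _)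
  rw [renewalMeasure, lintegral_sum_measure, ← ENNReal.tsum_geometric]
  exact ENNReal.tsum_le_tsum h

lemma complexMGF_conv (μ ν : Measure ℝ) [SFinite μ] [SFinite ν] (z : ℂ) :
    complexMGF id (Measure.conv μ ν) z = complexMGF id μ z * complexMGF id ν z := by
  unfold complexMGF Measure.conv
  rw [integral_map (by fun_prop) (by fun_prop), ← integral_prod_mul]
  congr 1; funext x
  rw [← Complex.exp_add]
  congr 1
  simp [mul_add]

lemma complexMGF_convPow (p : Measure ℝ) [SFinite p] (z : ℂ) (n : ℕ) :
    complexMGF id (convPow p n) z = complexMGF id p z ^ n := by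
  induction n with
  | zero => simp [convPow, complexMGF]
  | succ n ih => rw [convPow, complexMGF_conv, ih, pow_succ]

lemma enorm_cexp_mul (z : ℂ) (x : ℝ) :
    ‖Complex.exp (z * x)‖ₑ = ENNReal.ofReal (Real.exp (z.re * x)) := by
  rw [← ofReal_norm, Complex.norm_exp]; simp

lemma ofReal_exp_add_le (t x y : ℝ) : ENNReal.ofReal (Real.exp (t * (x + y))) ≤
    ENNReal.ofReal (Real.exp (t * x)) * ENNReal.ofReal (Real.exp (t * y)) := by
  rw [← ENNReal.ofReal_mul (Real.exp_nonneg _), ← Real.exp_add, mul_add]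

lemma lintegral_exp_renewalMeasure_lt_top (p : Measure ℝ) [SFinite p] {t : ℝ}
    (h : ∫⁻ x, ENNReal.ofReal (Real.exp (t * x)) ∂p < 1) :
    ∫⁻ x, ENNReal.ofReal (Real.exp (t * x)) ∂(renewalMeasure p) < ∞ := by
  refine (lintegral_renewalMeasure_le p (by fun_prop) (ofReal_exp_add_le t) (by simp)).trans_lt ?_
  rw [ENNReal.inv_lt_top]
  exact tsub_pos_of_lt h

lemma integrable_cexp_mul {μ : Measure ℝ} {z : ℂ}
    (h : ∫⁻ x, ENNReal.ofReal (Real.exp (z.re * x)) ∂μ < ∞) :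
    Integrable (fun x : ℝ => Complex.exp (z * x)) μ := by
  refine ⟨by fun_prop, ?_⟩
  simpa only [HasFiniteIntegral, enorm_cexp_mul] using h

lemma complexMGF_renewalMeasure (p : Measure ℝ) [SFinite p] {z : ℂ}
    (h : ∫⁻ x, ENNReal.ofReal (Real.exp (z.re * x)) ∂p < 1) :
    complexMGF id (renewalMeasure p) z = (1 - complexMGF id p z)⁻¹ := by
  have hint := integrable_cexp_mul (lintegral_exp_renewalMeasure_lt_top p h)
  have h1 := hasSum_integral_measure hint
  have hn : ‖complexMGF id p z‖ < 1 := by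
    suffices ‖complexMGF id p z‖ₑ < 1 by
      rw [← ofReal_norm, ← ENNReal.ofReal_one] at this
      exact (ENNReal.ofReal_lt_ofReal_iff one_pos).1 this
    refine (enorm_integral_le_lintegral_enorm _).trans_lt ?_
    simpa only [id, enorm_cexp_mul] using h
  have h2 := hasSum_geometric_of_norm_lt_one hn
  refine h1.unique ?_
  simp only [← complexMGF_convPow] at h2
  exact h2

end Renewal

/-! ### Exponential decay from a holomorphic transform -/

namespace Renewal

open Filter Topology Complex
open scoped FourierTransform

section Decay

variable {G : ℂ → ℂ} {K r r₀ : ℝ}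

/-- On the vertical lines bounding the strip, quadratic decay of `G` is dominated by a multiple of
the Cauchy density. -/
lemma norm_mul_exp_vertical_le (hr : 0 < r) (hr1 : r ≤ 1) (hK : 0 ≤ K)
    (hb : ∀ z : ℂ, |z.re| ≤ r → r ≤ ‖z‖ → ‖G z‖ ≤ K / ‖z‖ ^ 2) {σ : ℝ} (hσ : |σ| = r) (x y : ℝ) :
    ‖cexp (-(σ + y * I) * x) * G (σ + y * I)‖ ≤
      Real.exp (-σ * x) * (K / r ^ 2) * (1 + y ^ 2)⁻¹ := by
  have hre : ((σ : ℂ) + y * I).re = σ := by simp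
  have him : ((σ : ℂ) + y * I).im = y := by simp
  have hsq : ‖(σ : ℂ) + y * I‖ ^ 2 = r ^ 2 + y ^ 2 := by
    rw [Complex.sq_norm, Complex.normSq_apply, hre, him, ← hσ, sq_abs]; ring
  have hn : r ≤ ‖(σ : ℂ) + y * I‖ := by
    have h1 := Complex.abs_re_le_norm ((σ : ℂ) + y * I)
    rwa [hre, hσ] at h1
  have h := hb _ (by rw [hre, hσ]) hn
  rw [hsq] at h
  rw [norm_mul, Complex.norm_exp]
  have he : (-((σ : ℂ) + y * I) * x).re = -σ * x := by simp
  rw [he, mul_assoc]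
  refine mul_le_mul_of_nonneg_left (h.trans ?_) (Real.exp_nonneg _)
  rw [div_mul_eq_mul_div, ← div_eq_mul_inv, div_div]
  refine div_le_div_of_nonneg_left hK (by positivity) ?_
  have : r ^ 2 ≤ 1 := by nlinarith
  nlinarith [sq_nonneg y]

lemma integrable_mul_exp_vertical (hr : 0 < r) (hr1 : r ≤ 1) (hr₀ : r < r₀) (hK : 0 ≤ K)
    (hG : DifferentiableOn ℂ G {z | |z.re| < r₀})
    (hb : ∀ z : ℂ, |z.re| ≤ r → r ≤ ‖z‖ → ‖G z‖ ≤ K / ‖z‖ ^ 2) {σ : ℝ} (hσ : |σ| = r) (x : ℝ) :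
    Integrable fun y : ℝ => cexp (-(σ + y * I) * x) * G (σ + y * I) := by
  refine (integrable_inv_one_add_sq.const_mul (Real.exp (-σ * x) * (K / r ^ 2))).mono' ?_
    (ae_of_all _ fun y => norm_mul_exp_vertical_le hr hr1 hK hb hσ x y)
  refine (Continuous.mul (by fun_prop) ?_).aestronglyMeasurable
  exact hG.continuousOn.comp_continuous (by fun_prop) fun y => by simpa [hσ] using hr₀

lemma norm_integral_vertical_le (hr : 0 < r) (hr1 : r ≤ 1) (hK : 0 ≤ K)
    (hb : ∀ z : ℂ, |z.re| ≤ r → r ≤ ‖z‖ → ‖G z‖ ≤ K / ‖z‖ ^ 2) {σ : ℝ} (hσ : |σ| = r) (x : ℝ) :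
    ‖∫ y : ℝ, cexp (-(σ + y * I) * x) * G (σ + y * I)‖ ≤
      Real.exp (-σ * x) * (K / r ^ 2) * Real.pi := by
  rw [← integral_univ_inv_one_add_sq, ← integral_const_mul]
  exact norm_integral_le_of_norm_le (integrable_inv_one_add_sq.const_mul _)
    (ae_of_all _ fun y => norm_mul_exp_vertical_le hr hr1 hK hb hσ x y)

/-- The line of integration can be moved from `Re z = -r` to `Re z = r`. -/
lemma integral_vertical_eq (hr : 0 < r) (hr1 : r ≤ 1) (hr₀ : r < r₀) (hK : 0 ≤ K)
    (hG : DifferentiableOn ℂ G {z | |z.re| < r₀})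
    (hb : ∀ z : ℂ, |z.re| ≤ r → r ≤ ‖z‖ → ‖G z‖ ≤ K / ‖z‖ ^ 2) (x : ℝ) :
    ∫ y : ℝ, cexp (-((-r : ℝ) + y * I) * x) * G ((-r : ℝ) + y * I) =
      ∫ y : ℝ, cexp (-(r + y * I) * x) * G (r + y * I) := by
  set E : ℂ → ℂ := fun z => cexp (-z * x) * G z with hE
  have hEd : DifferentiableOn ℂ E {z | |z.re| < r₀} := by
    refine DifferentiableOn.mul ?_ hG
    exact (by fun_prop : Differentiable ℂ fun z : ℂ => cexp (-z * x)).differentiableOn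
  have hrect : ∀ R : ℝ, (∫ u : ℝ in (-r)..r, E (u + (-R : ℝ) * I)) -
      (∫ u : ℝ in (-r)..r, E (u + R * I)) + I • (∫ y : ℝ in (-R)..R, E (r + y * I)) -
      I • (∫ y : ℝ in (-R)..R, E ((-r : ℝ) + y * I)) = 0 := fun R => by
    have h := Complex.integral_boundary_rect_eq_zero_of_differentiableOn E ⟨-r, -R⟩ ⟨r, R⟩
      (hEd.mono ?_)
    · simpa only using h
    · intro z hz
      have hz1 : z.re ∈ uIcc (-r) r := hz.1
      rw [uIcc_of_le (by linarith)] at hz1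
      exact (abs_le.2 hz1).trans_lt hr₀
  -- the horizontal sides contribute `O(R⁻²)`
  have hside : ∀ s : ℝ, |s| = 1 →
      Tendsto (fun R : ℝ => ∫ u : ℝ in (-r)..r, E (u + (s * R : ℝ) * I)) atTop (𝓝 0) := by
    intro s hs
    have hlim : Tendsto (fun R : ℝ => Real.exp (r * |x|) * (K / R ^ 2) * |r - -r|) atTop (𝓝 0) := by
      have : Tendsto (fun R : ℝ => K / R ^ 2) atTop (𝓝 0) :=
        tendsto_const_nhds.div_atTop (tendsto_pow_atTop two_ne_zero)
      simpa using (this.const_mul (Real.exp (r * |x|))).mul_const |r - -r|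
    refine squeeze_zero_norm' ?_ hlim
    filter_upwards [eventually_ge_atTop 1] with R hR
    refine intervalIntegral.norm_integral_le_of_norm_le_const fun u hu => ?_
    rw [uIoc_of_le (by linarith)] at hu
    have hu' : |u| ≤ r := abs_le.2 ⟨hu.1.le, hu.2⟩
    have him : R ≤ ‖(u : ℂ) + (s * R : ℝ) * I‖ := by
      have h1 := Complex.abs_im_le_norm ((u : ℂ) + (s * R : ℝ) * I)
      simp only [add_im, ofReal_im, mul_im, ofReal_re, I_im, mul_one, I_re, mul_zero, zero_add,
        add_zero, abs_mul, hs, one_mul] at h1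
      exact (le_abs_self R).trans h1
    have h2 := hb ((u : ℂ) + (s * R : ℝ) * I) (by simpa using hu') (by linarith)
    rw [hE, norm_mul, Complex.norm_exp]
    refine mul_le_mul (Real.exp_le_exp.2 ?_) (h2.trans ?_) (norm_nonneg _) (Real.exp_nonneg _)
    · have : (-((u : ℂ) + (s * R : ℝ) * I) * x).re = -u * x := by simp
      rw [this]
      calc -u * x ≤ |-u * x| := le_abs_self _
        _ = |u| * |x| := by rw [abs_mul, abs_neg]
        _ ≤ r * |x| := by gcongr
    · gcongr
  have hv : ∀ σ : ℝ, |σ| = r → Tendsto (fun R : ℝ => ∫ y : ℝ in (-R)..R, E (σ + y * I)) atTop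
      (𝓝 (∫ y : ℝ, E (σ + y * I))) := fun σ hσ =>
    intervalIntegral_tendsto_integral
      (integrable_mul_exp_vertical hr hr1 hr₀ hK hG hb hσ x) tendsto_neg_atTop_atBot tendsto_id
  have hlim := (((hside (-1) (by simp)).sub (hside 1 (by simp))).add
    ((hv r (abs_of_pos hr)).const_smul I)).sub ((hv (-r) (by rw [abs_neg, abs_of_pos hr])).const_smul I)
  simp only [neg_mul, one_mul] at hlim
  simp only [hrect] at hlim
  have h0 := tendsto_nhds_unique hlim tendsto_const_nhds
  rw [sub_zero, zero_add, sub_eq_zero, smul_right_inj I_ne_zero] at h0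
  exact h0.symm

/-- Let `h` be continuous with two-sided Laplace transform `G` on the line `Re z = -r`. If `G` is
holomorphic on a neighbourhood of the strip `|Re z| ≤ r` and decays quadratically there, then `h`
decays exponentially at both ends. -/
lemma abs_le_of_transform {h : ℝ → ℝ} (hr : 0 < r) (hr1 : r ≤ 1) (hr₀ : r < r₀) (hK : 0 ≤ K)
    (hG : DifferentiableOn ℂ G {z | |z.re| < r₀})
    (hb : ∀ z : ℂ, |z.re| ≤ r → r ≤ ‖z‖ → ‖G z‖ ≤ K / ‖z‖ ^ 2) (hc : Continuous h)
    (hi : Integrable fun x => Real.exp (-r * x) * h x)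
    (ht : ∀ z : ℂ, z.re = -r → ∫ x : ℝ, cexp (z * x) * h x = G z) (x : ℝ) :
    |h x| ≤ K / r ^ 2 / 2 * Real.exp (r * x) ∧ |h x| ≤ K / r ^ 2 / 2 * Real.exp (-r * x) := by
  set F : ℝ → ℂ := fun x => ((Real.exp (-r * x) * h x : ℝ) : ℂ) with hF
  have hFi : Integrable F := hi.ofReal
  have hFc : Continuous F := by fun_prop
  have hFt : ∀ w : ℝ, 𝓕 F w = G ((-r : ℝ) + (-2 * Real.pi * w : ℝ) * I) := fun w => by
    rw [Real.fourier_real_eq_integral_exp_smul, ← ht _ (by simp)]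
    congr 1; funext v
    rw [hF]
    simp only [smul_eq_mul, ofReal_mul, ofReal_exp]
    rw [← mul_assoc, ← Complex.exp_add]
    congr 2
    push_cast
    ring
  have hint := integrable_mul_exp_vertical hr hr1 hr₀ hK hG hb (σ := -r)
    (by rw [abs_neg, abs_of_pos hr]) 0
  simp only [ofReal_zero, mul_zero, Complex.exp_zero, one_mul] at hint
  have hpi : (-2 * Real.pi) ≠ 0 := by simp [Real.pi_ne_zero]
  have hFti : Integrable (𝓕 F) := by
    have := hint.comp_mul_left' hpi
    exact this.congr (ae_of_all _ fun w => (hFt w).symm)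
  -- the inversion formula, as an integral over the line `Re z = -r`
  have hinv : (h x : ℂ) = ((1 / (2 * Real.pi) : ℝ) : ℂ) *
      ∫ y : ℝ, cexp (-((-r : ℝ) + y * I) * x) * G ((-r : ℝ) + y * I) := by
    have h1 := congrFun (hFc.fourierInv_fourier_eq hFi hFti) x
    rw [Real.fourierInv_eq'] at h1
    have h2 : (h x : ℂ) = cexp (r * x) * F x := by
      rw [hF]
      simp only [ofReal_mul, ofReal_exp]
      rw [← mul_assoc, ← Complex.exp_add]
      simp
    rw [h2, ← h1, ← integral_const_mul]
    have h3 := Measure.integral_comp_mul_left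
      (fun y : ℝ => cexp (-((-r : ℝ) + y * I) * x) * G ((-r : ℝ) + y * I)) (-2 * Real.pi)
    rw [show |(-2 * Real.pi)⁻¹| = 1 / (2 * Real.pi) by
      rw [abs_inv, abs_of_neg (by linarith [Real.pi_pos])]; field_simp] at h3
    rw [← real_smul (x := 1 / (2 * Real.pi)), ← h3]
    congr 1; funext w
    rw [hFt, smul_eq_mul, ← mul_assoc, ← Complex.exp_add]
    congr 2
    simp only [RCLike.inner_apply, conj_trivial]
    push_cast
    ring
  have hpos := Real.pi_pos
  have hfin : ∀ σ : ℝ, |σ| = r → (h x : ℂ) = ((1 / (2 * Real.pi) : ℝ) : ℂ) *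
      (∫ y : ℝ, cexp (-(σ + y * I) * x) * G (σ + y * I)) →
      |h x| ≤ K / r ^ 2 / 2 * Real.exp (-σ * x) := fun σ hσ he => by
    rw [← Real.norm_eq_abs, ← Complex.norm_real, he, norm_mul, Complex.norm_real,
      Real.norm_of_nonneg (by positivity)]
    calc _ ≤ 1 / (2 * Real.pi) * (Real.exp (-σ * x) * (K / r ^ 2) * Real.pi) :=
          mul_le_mul_of_nonneg_left (norm_integral_vertical_le hr hr1 hK hb hσ x) (by positivity)
      _ = _ := by field_simp
  refine ⟨?_, ?_⟩
  · simpa using hfin (-r) (by rw [abs_neg, abs_of_pos hr]) hinv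
  · rw [integral_vertical_eq hr hr1 hr₀ hK hG hb] at hinv
    exact hfin r (abs_of_pos hr) hinv

end Decay

end Renewal

/-! ### Transforms of measures with exponential moments -/

namespace Renewal

open Filter Topology Complex ProbabilityTheory

section Moments

variable {μ : Measure ℝ} {τ : ℝ}

lemma abs_mul_exp_le (hτ : 0 < τ) {s x : ℝ} (hs : s ≤ τ / 2) :
    |x| * Real.exp (s * |x|) ≤ 2 / τ * Real.exp (τ * |x|) := by
  have h1 : τ * |x| / 2 ≤ Real.exp (τ * |x| / 2) := by
    linarith [Real.add_one_le_exp (τ * |x| / 2)]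
  have h2 : Real.exp (s * |x|) ≤ Real.exp (τ * |x| / 2) :=
    Real.exp_le_exp.2 (by nlinarith [abs_nonneg x])
  have h3 : |x| ≤ 2 / τ * Real.exp (τ * |x| / 2) := by
    rw [div_mul_eq_mul_div, le_div_iff₀ hτ]; linarith
  calc |x| * Real.exp (s * |x|)
      ≤ 2 / τ * Real.exp (τ * |x| / 2) * Real.exp (τ * |x| / 2) := by gcongr
    _ = 2 / τ * Real.exp (τ * |x|) := by rw [mul_assoc, ← Real.exp_add]; ring_nf

lemma sq_mul_exp_le (hτ : 0 < τ) {s x : ℝ} (hs : s ≤ τ / 2) :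
    x ^ 2 * Real.exp (s * |x|) ≤ 8 / τ ^ 2 * Real.exp (τ * |x|) := by
  have h1 := Real.quadratic_le_exp_of_nonneg (x := τ * |x| / 2) (by positivity)
  have h0 : 0 ≤ τ * |x| / 2 := by positivity
  have h2 : Real.exp (s * |x|) ≤ Real.exp (τ * |x| / 2) :=
    Real.exp_le_exp.2 (by nlinarith [abs_nonneg x])
  have h3 : x ^ 2 ≤ 8 / τ ^ 2 * Real.exp (τ * |x| / 2) := by
    rw [div_mul_eq_mul_div, le_div_iff₀ (by positivity), ← sq_abs x]; nlinarith
  calc x ^ 2 * Real.exp (s * |x|)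
      ≤ 8 / τ ^ 2 * Real.exp (τ * |x| / 2) * Real.exp (τ * |x| / 2) := by gcongr
    _ = 8 / τ ^ 2 * Real.exp (τ * |x|) := by rw [mul_assoc, ← Real.exp_add]; ring_nf

lemma abs_exp_sub_one_le (u : ℝ) : |Real.exp u - 1| ≤ |u| * Real.exp |u| := by
  have h := Complex.norm_exp_sub_sum_le_norm_mul_exp u 1
  simp only [Finset.range_one, Finset.sum_singleton, pow_zero, Nat.factorial_zero, Nat.cast_one,
    div_one, pow_one, Complex.norm_real, Real.norm_eq_abs] at h
  rwa [← Complex.ofReal_exp, ← Complex.ofReal_one, ← Complex.ofReal_sub, Complex.norm_real,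
    Real.norm_eq_abs] at h

lemma integrable_cexp_of_abs_re_le (hi : Integrable (fun x => Real.exp (τ * |x|)) μ) {z : ℂ}
    (hz : |z.re| ≤ τ) : Integrable (fun x : ℝ => cexp (z * x)) μ := by
  refine hi.mono' (by fun_prop) (ae_of_all _ fun x => ?_)
  rw [Complex.norm_exp, Real.exp_le_exp]
  have : (z * x).re = z.re * x := by simp
  rw [this]
  calc z.re * x ≤ |z.re * x| := le_abs_self _
    _ = |z.re| * |x| := abs_mul _ _
    _ ≤ τ * |x| := by gcongr

lemma integrable_exp_of_abs_le (hi : Integrable (fun x => Real.exp (τ * |x|)) μ) {s : ℝ}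
    (hs : |s| ≤ τ) : Integrable (fun x : ℝ => Real.exp (s * x)) μ := by
  have h := (integrable_cexp_of_abs_re_le hi (z := s) (by simpa using hs)).re
  refine h.congr (ae_of_all _ fun x => ?_)
  simp only [RCLike.re_eq_complex_re]
  rw [← Complex.ofReal_mul, ← Complex.ofReal_exp, Complex.ofReal_re]

lemma integrable_id_of_exp (hτ : 0 < τ) (hi : Integrable (fun x => Real.exp (τ * |x|)) μ) :
    Integrable (fun x : ℝ => x) μ := by
  refine (hi.const_mul (2 / τ)).mono' (by fun_prop) (ae_of_all _ fun x => ?_)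
  have := abs_mul_exp_le hτ (s := 0) (x := x) (by positivity)
  simpa using this

lemma differentiableOn_complexMGF_strip (hi : Integrable (fun x => Real.exp (τ * |x|)) μ) :
    DifferentiableOn ℂ (complexMGF id μ) {z | |z.re| < τ} := by
  refine differentiableOn_complexMGF.mono fun z hz => ?_
  have hsub : Ioo (-τ) τ ⊆ integrableExpSet id μ := fun s hs =>
    integrable_exp_of_abs_le hi (abs_le.2 ⟨hs.1.le, hs.2.le⟩)
  exact interior_mono hsub (by rw [interior_Ioo]; exact abs_lt.1 hz)

/-- First-order expansion of the transform at `0`, with a quadratic remainder. -/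
lemma norm_complexMGF_sub_le [IsProbabilityMeasure μ] (hτ : 0 < τ)
    (hi : Integrable (fun x => Real.exp (τ * |x|)) μ) {z : ℂ} (hz : ‖z‖ ≤ τ / 2) :
    ‖complexMGF id μ z - 1 - mean μ * z‖ ≤
      8 / τ ^ 2 * (∫ x, Real.exp (τ * |x|) ∂μ) * ‖z‖ ^ 2 := by
  have hre : |z.re| ≤ τ := (Complex.abs_re_le_norm z).trans (hz.trans (by linarith))
  have he := integrable_cexp_of_abs_re_le hi hre
  have hx := integrable_id_of_exp hτ hi
  have hx' : Integrable (fun x : ℝ => (x : ℂ) * z) μ := hx.ofReal.mul_const z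
  have h1 : complexMGF id μ z - 1 - mean μ * z = ∫ x : ℝ, (cexp (z * x) - 1 - x * z) ∂μ := by
    have he1 : Integrable (fun x : ℝ => cexp (z * x) - 1) μ := he.sub (integrable_const _)
    rw [integral_sub he1 hx', integral_sub he (integrable_const _), integral_mul_const,
      integral_complex_ofReal]
    simp [complexMGF, mean]
  rw [h1, ← integral_const_mul, ← integral_mul_const]
  refine norm_integral_le_of_norm_le ((hi.const_mul _).mul_const _) (ae_of_all _ fun x => ?_)
  have h2 := Complex.norm_exp_sub_sum_le_norm_mul_exp (z * x) 2
  simp only [Finset.sum_range_succ, Finset.range_zero, Finset.sum_empty, pow_zero,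
    Nat.factorial_zero, Nat.cast_one, div_one, zero_add, pow_one, Nat.factorial_one,
    norm_mul, Complex.norm_real, Real.norm_eq_abs] at h2
  rw [sub_sub, mul_comm (x : ℂ) z]
  refine h2.trans ?_
  rw [mul_pow, sq_abs, mul_assoc, mul_comm]
  exact mul_le_mul_of_nonneg_right (sq_mul_exp_le hτ hz) (sq_nonneg _)

lemma hasDerivAt_complexMGF_zero (hτ : 0 < τ)
    (hi : Integrable (fun x => Real.exp (τ * |x|)) μ) :
    HasDerivAt (complexMGF id μ) (mean μ : ℂ) 0 := by
  have hsub : Ioo (-τ) τ ⊆ integrableExpSet id μ := fun s hs =>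
    integrable_exp_of_abs_le hi (abs_le.2 ⟨hs.1.le, hs.2.le⟩)
  have h := hasDerivAt_complexMGF (X := id) (μ := μ) (z := 0)
    (interior_mono hsub (by rw [interior_Ioo]; simpa using hτ))
  rw [mean, ← integral_complex_ofReal]
  simpa using h

/-- The transform varies slowly in the horizontal direction, uniformly in the height. -/
lemma norm_complexMGF_sub_imaginary_le (hτ : 0 < τ)
    (hi : Integrable (fun x => Real.exp (τ * |x|)) μ) {z : ℂ} (hz : |z.re| ≤ τ / 2) :
    ‖complexMGF id μ z - complexMGF id μ (z.im * I)‖ ≤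
      |z.re| * (2 / τ * ∫ x, Real.exp (τ * |x|) ∂μ) := by
  have he := integrable_cexp_of_abs_re_le hi (z := z) (by linarith)
  have he' := integrable_cexp_of_abs_re_le hi (z := z.im * I) (by simpa using hτ.le)
  unfold complexMGF
  simp only [id]
  rw [← integral_sub he he', ← integral_const_mul, ← integral_const_mul]
  refine norm_integral_le_of_norm_le ((hi.const_mul _).const_mul _) (ae_of_all _ fun x => ?_)
  have h1 : cexp (z * x) - cexp (z.im * I * x) =
      cexp ((z.im * x : ℝ) * I) * ((Real.exp (z.re * x) - 1 : ℝ) : ℂ) := by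
    push_cast
    rw [mul_sub, ← Complex.exp_add]
    congr 1
    · congr 1
      conv_lhs => rw [← Complex.re_add_im z]
      ring
    · rw [mul_one]; congr 1; ring
  rw [h1, norm_mul, Complex.norm_exp_ofReal_mul_I, one_mul, Complex.norm_real, Real.norm_eq_abs]
  refine (abs_exp_sub_one_le _).trans ?_
  rw [abs_mul, mul_assoc]
  exact mul_le_mul_of_nonneg_left (abs_mul_exp_le hτ hz) (abs_nonneg _)

lemma norm_complexMGF_le_toReal (z : ℂ) :
    ‖complexMGF id μ z‖ₑ ≤ ∫⁻ x, ENNReal.ofReal (Real.exp (z.re * x)) ∂μ := by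
  refine (enorm_integral_le_lintegral_enorm _).trans_eq ?_
  simp only [id, enorm_cexp_mul]

end Moments

section Doubling

/-- If `charFun a t` is close to the total mass in modulus, then so is `charFun a (2 * t)`; this
carries a bound on the modulus at high frequencies down to low ones. -/
lemma mass_sub_norm_charFun_two_mul_le (a : Measure ℝ) [IsFiniteMeasure a] (t : ℝ) :
    a.real univ - ‖charFun a (2 * t)‖ ≤ 4 * (a.real univ - ‖charFun a t‖) := by
  set θ := (charFun a t).arg
  have hre : ∀ s ψ : ℝ, (cexp (-(ψ * I)) * charFun a s).re = ∫ x, Real.cos (s * x - ψ) ∂a := by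
    intro s ψ
    have hint : Integrable (fun x : ℝ => cexp (-(ψ * I)) * cexp (s * x * I)) a := by
      refine (integrable_const (1 : ℝ)).mono' (by fun_prop) (ae_of_all _ fun x => ?_)
      rw [← Complex.exp_add, Complex.norm_exp]
      simp
    rw [charFun_apply_real, ← integral_const_mul]
    rw [← RCLike.re_eq_complex_re, ← integral_re hint]
    congr 1; funext x
    rw [← Complex.exp_add, RCLike.re_eq_complex_re,
      show -(ψ * I) + s * x * I = ((s * x - ψ : ℝ) : ℂ) * I by push_cast; ring,
      Complex.exp_ofReal_mul_I_re]
  have h1 : ‖charFun a t‖ = ∫ x, Real.cos (t * x - θ) ∂a := by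
    rw [← hre]
    conv_rhs => rw [← Complex.norm_mul_exp_arg_mul_I (charFun a t)]
    rw [mul_left_comm, ← Complex.exp_add, neg_add_cancel, Complex.exp_zero, mul_one,
      Complex.ofReal_re]
  have h2 : ∫ x, Real.cos (2 * (t * x - θ)) ∂a ≤ ‖charFun a (2 * t)‖ := by
    have : ∫ x, Real.cos (2 * (t * x - θ)) ∂a = (cexp (-((2 * θ : ℝ) * I)) * charFun a (2 * t)).re := by
      rw [hre]; congr 1; funext x; congr 1; ring
    rw [this]
    refine (Complex.re_le_norm _).trans ?_
    rw [norm_mul, ← neg_mul, ← Complex.ofReal_neg, Complex.norm_exp_ofReal_mul_I, one_mul]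
  have hcos : ∀ g : ℝ → ℝ, Continuous g → Integrable (fun x => Real.cos (g x)) a := fun g hg =>
    (integrable_const (1 : ℝ)).mono' (by fun_prop) (ae_of_all _ fun x => Real.abs_cos_le_one _)
  have h3 : ∫ x, (1 - Real.cos (2 * (t * x - θ))) ∂a ≤ ∫ x, 4 * (1 - Real.cos (t * x - θ)) ∂a := by
    refine integral_mono ((integrable_const _).sub (hcos _ (by fun_prop)))
      (((integrable_const _).sub (hcos _ (by fun_prop))).const_mul _) fun x => ?_
    have hc1 := Real.cos_le_one (t * x - θ)
    simp only [Real.cos_two_mul]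
    nlinarith [sq_nonneg (1 - Real.cos (t * x - θ))]
  rw [integral_const_mul, integral_sub (integrable_const _) (hcos _ (by fun_prop)),
    integral_sub (integrable_const _) (hcos _ (by fun_prop))] at h3
  simp only [integral_const, smul_eq_mul, mul_one] at h3
  rw [h1]
  linarith

lemma mass_sub_norm_charFun_pow_two_mul_le (a : Measure ℝ) [IsFiniteMeasure a] (t : ℝ) (k : ℕ) :
    a.real univ - ‖charFun a (2 ^ k * t)‖ ≤ 4 ^ k * (a.real univ - ‖charFun a t‖) := by
  induction k with
  | zero => simp
  | succ k ih =>
    have h := mass_sub_norm_charFun_two_mul_le a (2 ^ k * t)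
    rw [pow_succ', pow_succ', mul_assoc, mul_assoc]
    linarith

end Doubling

section Density

variable {f : ℝ → ℝ} {T : ℝ}

lemma tsupport_iteratedDeriv_two_subset : tsupport (iteratedDeriv 2 f) ⊆ tsupport f := by
  rw [iteratedDeriv_succ, iteratedDeriv_one]
  exact (tsupport_deriv_subset (𝕜 := ℝ)).trans (tsupport_deriv_subset (𝕜 := ℝ))

/-- Two integrations by parts. -/
lemma sq_mul_integral_cexp_mul (hf : ContDiff ℝ 2 f) (hs : HasCompactSupport f) (z : ℂ) :
    z ^ 2 * ∫ x : ℝ, cexp (z * x) * f x = ∫ x : ℝ, cexp (z * x) * (iteratedDeriv 2 f x : ℝ) := by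
  have hf1 : ContDiff ℝ 1 (deriv f) :=
    ((contDiff_succ_iff_deriv (n := 1)).1 (by simpa [one_add_one_eq_two] using hf)).2.2
  have hd1 : Continuous (deriv f) := hf1.continuous
  have hd2 : Continuous (deriv (deriv f)) := hf1.continuous_deriv le_rfl
  have hs1 : HasCompactSupport (deriv f) := hs.deriv
  have hs2 : HasCompactSupport (deriv (deriv f)) := hs1.deriv
  have hint : ∀ (w : ℂ) (g : ℝ → ℝ), Continuous g → HasCompactSupport g →
      Integrable fun x : ℝ => w * cexp (z * x) * g x := fun w g hg hgs => by
    refine Continuous.integrable_of_hasCompactSupport (by fun_prop) ?_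
    exact (hgs.comp_left (g := fun y : ℝ => (y : ℂ)) (by simp)).mul_left
  have hu : ∀ x : ℝ, HasDerivAt (fun x : ℝ => cexp (z * x)) (z * cexp (z * x)) x := fun x => by
    have h := ((hasDerivAt_id (x : ℂ)).const_mul z).cexp.comp_ofReal
    simpa [mul_comm] using h
  have parts : ∀ g : ℝ → ℝ, ContDiff ℝ 1 g → HasCompactSupport g →
      ∫ x : ℝ, cexp (z * x) * (deriv g x : ℝ) = -(z * ∫ x : ℝ, cexp (z * x) * g x) := by
    intro g hg hgs
    rw [← integral_const_mul]
    have h := integral_mul_deriv_eq_deriv_mul_of_integrable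
      (u := fun x : ℝ => cexp (z * x)) (v := fun x => (g x : ℂ))
      (u' := fun x : ℝ => z * cexp (z * x)) (v' := fun x => ((deriv g x : ℝ) : ℂ))
      (fun x _ => hu x)
      (fun x _ => ((hg.differentiable one_ne_zero) x).hasDerivAt.ofReal_comp)
      (by simpa [Pi.mul_def] using hint 1 _ (hg.continuous_deriv le_rfl) hgs.deriv)
      (by simpa [Pi.mul_def] using hint z _ hg.continuous hgs)
      (by simpa [Pi.mul_def] using hint 1 _ hg.continuous hgs)
    rw [h]
    simp only [mul_assoc]
  rw [iteratedDeriv_succ, iteratedDeriv_one, parts _ hf1 hs1, parts _ (hf.of_le (by norm_num)) hs]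
  ring

lemma complexMGF_withDensity (hf : Measurable f) (h0 : ∀ x, 0 ≤ f x) (z : ℂ) :
    complexMGF id (volume.withDensity fun x => ENNReal.ofReal (f x)) z =
      ∫ x : ℝ, cexp (z * x) * f x := by
  unfold complexMGF
  rw [integral_withDensity_eq_integral_toReal_smul (by fun_prop) (by simp)]
  congr 1; funext x
  rw [ENNReal.toReal_ofReal (h0 x), real_smul, mul_comm]
  rfl

/-- The transform of a `C²` density supported in `(-T, T)` decays quadratically. -/
lemma norm_complexMGF_withDensity_le (hf : ContDiff ℝ 2 f) (h0 : ∀ x, 0 ≤ f x)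
    (hs : tsupport f ⊆ Ioo (-T) T) {z : ℂ} (hz : z ≠ 0) :
    ‖complexMGF id (volume.withDensity fun x => ENNReal.ofReal (f x)) z‖ ≤
      Real.exp (|z.re| * |T|) * (∫ x in (-T)..T, |iteratedDeriv 2 f x|) / ‖z‖ ^ 2 := by
  have hcs : HasCompactSupport f :=
    isCompact_Icc.of_isClosed_subset (isClosed_tsupport f) (hs.trans Ioo_subset_Icc_self)
  rw [complexMGF_withDensity hf.continuous.measurable h0, le_div_iff₀ (by positivity), ← norm_pow, mul_comm,
    ← norm_mul, sq_mul_integral_cexp_mul hf hcs]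
  have hsub : Function.support (iteratedDeriv 2 f) ⊆ Ioo (-T) T :=
    (subset_tsupport _).trans (tsupport_iteratedDeriv_two_subset.trans hs)
  have h2 : Continuous (iteratedDeriv 2 f) := hf.continuous_iteratedDeriv 2 le_rfl
  rcases lt_or_ge T 0 with hT | hT
  · have hz : iteratedDeriv 2 f = 0 := by
      rw [Ioo_eq_empty (by linarith)] at hsub
      exact Function.support_eq_empty_iff.1 (subset_empty_iff.1 hsub)
    simp [hz]
  have hset : ∫ x : ℝ, cexp (z * x) * (iteratedDeriv 2 f x : ℝ) =
      ∫ x in (-T)..T, cexp (z * x) * (iteratedDeriv 2 f x : ℝ) := by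
    rw [intervalIntegral.integral_eq_integral_of_support_subset]
    refine fun x hx => Ioo_subset_Ioc_self (hsub ?_)
    intro h
    exact hx (by simp [h])
  rw [hset, ← intervalIntegral.integral_const_mul]
  refine intervalIntegral.norm_integral_le_of_norm_le (by linarith) (ae_of_all _ fun x hx => ?_)
    (Continuous.intervalIntegrable (by fun_prop) _ _)
  rw [norm_mul, Complex.norm_exp, Complex.norm_real, Real.norm_eq_abs]
  gcongr
  have h4 : (z * x).re = z.re * x := by simp
  rw [h4]
  calc z.re * x ≤ |z.re * x| := le_abs_self _
    _ = |z.re| * |x| := abs_mul _ _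
    _ ≤ |z.re| * |T| := by
      refine mul_le_mul_of_nonneg_left ?_ (abs_nonneg _)
      rw [abs_of_nonneg hT]
      exact abs_le.2 ⟨hx.1.le, hx.2⟩

end Density

end Renewal

/-! ### Uniform lower bounds in a strip -/

namespace Renewal

open Filter Topology Complex ProbabilityTheory

/-- The quantitative content of `IsUniformFamily` for one member: a probability measure `p` splits
as `a + b`, where `a` has the density `f`. In the application `a = (1 - lam) • Φ` and
`b = lam • Ψ`. The weights are absorbed so that `b ≤ p` inherits the exponential moments of `p`,
which `Ψ` itself need not have when `lam = 0`. -/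
structure Admissible (τ M m γ T B : ℝ) (p a b : Measure ℝ) (f : ℝ → ℝ) : Prop where
  prob : IsProbabilityMeasure p
  add : p = a + b
  univ_le : b univ ≤ ENNReal.ofReal γ
  nonneg : ∀ x, 0 ≤ f x
  density : a = volume.withDensity fun x => ENNReal.ofReal (f x)
  contDiff : ContDiff ℝ 2 f
  tsupport_subset : tsupport f ⊆ Ioo (-T) T
  integral_deriv_le : ∫ x in (-T)..T, |iteratedDeriv 2 f x| ≤ B
  le_mean : m ≤ mean p
  moment_le : ∫⁻ x, ENNReal.ofReal (Real.exp (τ * |x|)) ∂p ≤ ENNReal.ofReal M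

namespace Admissible

variable {τ M m γ T B : ℝ} {p a b : Measure ℝ} {f : ℝ → ℝ}

lemma le_left (h : Admissible τ M m γ T B p a b f) : a ≤ p := by
  rw [h.add]; exact Measure.le_add_right le_rfl

lemma le_right (h : Admissible τ M m γ T B p a b f) : b ≤ p := by
  rw [h.add]; exact Measure.le_add_left le_rfl

lemma isFiniteMeasure_left (h : Admissible τ M m γ T B p a b f) : IsFiniteMeasure a :=
  have := h.prob
  isFiniteMeasure_of_le p h.le_left

lemma isFiniteMeasure_right (h : Admissible τ M m γ T B p a b f) : IsFiniteMeasure b :=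
  have := h.prob
  isFiniteMeasure_of_le p h.le_right

lemma hasCompactSupport (h : Admissible τ M m γ T B p a b f) : HasCompactSupport f :=
  isCompact_Icc.of_isClosed_subset (isClosed_tsupport f)
    (h.tsupport_subset.trans Ioo_subset_Icc_self)

lemma integrable_exp (h : Admissible τ M m γ T B p a b f) :
    Integrable (fun x => Real.exp (τ * |x|)) p := by
  refine ⟨by fun_prop, ?_⟩
  rw [hasFiniteIntegral_iff_ofReal (ae_of_all _ fun x => Real.exp_nonneg _)]
  exact h.moment_le.trans_lt ENNReal.ofReal_lt_top

lemma integral_exp_le (h : Admissible τ M m γ T B p a b f) (hM : 0 ≤ M) :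
    ∫ x, Real.exp (τ * |x|) ∂p ≤ M := by
  rw [integral_eq_lintegral_of_nonneg_ae (ae_of_all _ fun x => Real.exp_nonneg _) (by fun_prop)]
  exact ENNReal.toReal_le_of_le_ofReal hM h.moment_le

lemma mass_eq (h : Admissible τ M m γ T B p a b f) : a.real univ + b.real univ = 1 := by
  have := h.prob
  have := h.isFiniteMeasure_left
  have := h.isFiniteMeasure_right
  rw [← measureReal_add_apply, ← h.add, probReal_univ]

lemma mass_right_le (h : Admissible τ M m γ T B p a b f) (hγ : 0 ≤ γ) : b.real univ ≤ γ :=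
  ENNReal.toReal_le_of_le_ofReal hγ h.univ_le

lemma complexMGF_add (h : Admissible τ M m γ T B p a b f) {z : ℂ} (hz : |z.re| ≤ τ) :
    complexMGF id p z = complexMGF id a z + complexMGF id b z := by
  have hi := integrable_cexp_of_abs_re_le h.integrable_exp hz
  unfold complexMGF
  conv_lhs => rw [h.add]
  exact integral_add_measure (hi.mono_measure h.le_left) (hi.mono_measure h.le_right)

lemma norm_complexMGF_left_le (h : Admissible τ M m γ T B p a b f) {z : ℂ} (hz : z ≠ 0) :
    ‖complexMGF id a z‖ ≤ Real.exp (|z.re| * |T|) * B / ‖z‖ ^ 2 := by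
  rw [h.density]
  refine (norm_complexMGF_withDensity_le h.contDiff h.nonneg h.tsupport_subset hz).trans ?_
  have := h.integral_deriv_le
  gcongr

/-- Away from `0` the characteristic function of `p` stays away from `1`: the density of `a` makes
`charFun a` small at high frequencies, and frequency doubling brings this down to `δ ≤ |t|`. -/
lemma exists_le_norm_one_sub_imaginary (hτ : 0 < τ) (hγ : 0 ≤ γ) (hγ1 : γ < 1) {δ : ℝ} (hδ : 0 < δ) :
    ∃ c : ℝ, 0 < c ∧ ∀ (p a b : Measure ℝ) (f : ℝ → ℝ), Admissible τ M m γ T B p a b f →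
      ∀ t : ℝ, δ ≤ |t| → c ≤ ‖1 - complexMGF id p (t * I)‖ := by
  obtain ⟨k, hk⟩ := pow_unbounded_of_one_lt (B / (δ ^ 2 * ((1 - γ) / 2))) (by norm_num : (1 : ℝ) < 4)
  rw [div_lt_iff₀ (by have := sub_pos.2 hγ1; positivity)] at hk
  refine ⟨(1 - γ) / 2 / 4 ^ k, by have := sub_pos.2 hγ1; positivity, ?_⟩
  intro p a b f h t ht
  have := h.prob
  have := h.isFiniteMeasure_left
  have := h.isFiniteMeasure_right
  have ht0 : t ≠ 0 := by
    rintro rfl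
    simp at ht
    linarith
  have hadd : charFun p t = charFun a t + charFun b t := by
    simpa only [complexMGF_id_mul_I] using h.complexMGF_add (z := t * I) (by simpa using hτ.le)
  have hhigh : ‖charFun a (2 ^ k * t)‖ ≤ (1 - γ) / 2 := by
    rw [← complexMGF_id_mul_I]
    refine (h.norm_complexMGF_left_le (by simp [ht0])).trans ?_
    have hsq : δ ^ 2 ≤ t ^ 2 := by
      rw [← sq_abs t]
      gcongr
    have h4 : ((2 : ℝ) ^ k) ^ 2 = 4 ^ k := by rw [← pow_mul, mul_comm, pow_mul]; norm_num
    simp only [norm_mul, Complex.norm_real, Real.norm_eq_abs, norm_I, mul_one]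
    simp only [ofReal_mul, mul_re, ofReal_re, ofReal_im, I_re, I_im, mul_zero, mul_one, sub_self,
      mul_im, zero_mul, add_zero, abs_zero, Real.exp_zero, one_mul]
    rw [mul_pow, sq_abs, sq_abs, h4, div_le_iff₀ (by positivity)]
    have : 4 ^ k * (δ ^ 2 * ((1 - γ) / 2)) ≤ 4 ^ k * (t ^ 2 * ((1 - γ) / 2)) := by
      have := sub_pos.2 hγ1
      gcongr
    linarith
  have hdbl := mass_sub_norm_charFun_pow_two_mul_le a t k
  have hmass := h.mass_eq
  have hb := h.mass_right_le hγ
  have hbn := norm_charFun_le (μ := b) t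
  rw [complexMGF_id_mul_I, hadd]
  have htri : 1 - (‖charFun a t‖ + ‖charFun b t‖) ≤ ‖1 - (charFun a t + charFun b t)‖ := by
    have h1 := norm_sub_norm_le (1 : ℂ) (charFun a t + charFun b t)
    have h2 := norm_add_le (charFun a t) (charFun b t)
    rw [norm_one] at h1
    linarith
  refine le_trans ?_ htri
  rw [div_le_iff₀ (by positivity)]
  have h3 : (1 - (‖charFun a t‖ + ‖charFun b t‖)) * 4 ^ k ≥ (a.real univ - ‖charFun a t‖) * 4 ^ k :=
    mul_le_mul_of_nonneg_right (by linarith) (by positivity)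
  linarith

/-- `∫ e^{s|x|} db` exceeds the mass of `b` by at most `O(s)`. -/
lemma lintegral_exp_right_le (h : Admissible τ M m γ T B p a b f) (hτ : 0 < τ) (hγ : 0 ≤ γ)
    (hM : 0 ≤ M) {s : ℝ} (hs : 0 ≤ s) (hs' : s ≤ τ / 2) :
    ∫⁻ x, ENNReal.ofReal (Real.exp (s * |x|)) ∂b ≤ ENNReal.ofReal (γ + s * (2 / τ * M)) := by
  have hpt : ∀ x : ℝ, ENNReal.ofReal (Real.exp (s * |x|)) ≤
      1 + ENNReal.ofReal (s * (2 / τ)) * ENNReal.ofReal (Real.exp (τ * |x|)) := fun x => by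
    rw [← ENNReal.ofReal_one, ← ENNReal.ofReal_mul (by positivity),
      ← ENNReal.ofReal_add zero_le_one (by positivity)]
    refine ENNReal.ofReal_le_ofReal ?_
    have h1 := le_of_abs_le (abs_exp_sub_one_le (s * |x|))
    rw [abs_of_nonneg (by positivity : 0 ≤ s * |x|)] at h1
    have h2 := mul_le_mul_of_nonneg_left (abs_mul_exp_le hτ (x := x) hs') hs
    linarith
  calc ∫⁻ x, ENNReal.ofReal (Real.exp (s * |x|)) ∂b
      ≤ ∫⁻ x, (1 + ENNReal.ofReal (s * (2 / τ)) * ENNReal.ofReal (Real.exp (τ * |x|))) ∂b :=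
        lintegral_mono hpt
    _ = b univ + ENNReal.ofReal (s * (2 / τ)) * ∫⁻ x, ENNReal.ofReal (Real.exp (τ * |x|)) ∂b := by
        rw [lintegral_add_left (by fun_prop), lintegral_one, lintegral_const_mul _ (by fun_prop)]
    _ ≤ ENNReal.ofReal γ + ENNReal.ofReal (s * (2 / τ)) * ENNReal.ofReal M := by
        gcongr
        · exact h.univ_le
        · exact (lintegral_mono' h.le_right le_rfl).trans h.moment_le
    _ = ENNReal.ofReal (γ + s * (2 / τ * M)) := by
        rw [← ENNReal.ofReal_mul (by positivity), ← ENNReal.ofReal_add hγ (by positivity), mul_assoc]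

/-- The tilt `e^{-sx} p(dx)` has mass `< 1` for small `s > 0`, as the mean is positive. -/
lemma lintegral_exp_neg_lt_one (h : Admissible τ M m γ T B p a b f) (hτ : 0 < τ)
    (hm : 0 < m) (hM : 0 ≤ M) {s : ℝ} (hs : 0 < s) (hs1 : s ≤ τ / 2)
    (hs2 : 8 / τ ^ 2 * M * s ≤ m / 2) :
    ∫⁻ x, ENNReal.ofReal (Real.exp (-s * x)) ∂p < 1 := by
  have := h.prob
  have hi := integrable_exp_of_abs_le h.integrable_exp (s := -s)
    (by rw [abs_neg, abs_of_pos hs]; linarith)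
  rw [← ofReal_integral_eq_lintegral_ofReal hi (ae_of_all _ fun x => Real.exp_nonneg _),
    ← ENNReal.ofReal_one, ENNReal.ofReal_lt_ofReal_iff one_pos]
  have h1 := norm_complexMGF_sub_le (z := ((-s : ℝ) : ℂ)) hτ h.integrable_exp
    (by rw [Complex.norm_real, Real.norm_eq_abs, abs_neg, abs_of_pos hs]; exact hs1)
  rw [complexMGF_ofReal, Complex.norm_real, Real.norm_eq_abs, abs_neg, abs_of_pos hs,
    ← Complex.ofReal_one, ← Complex.ofReal_mul, ← Complex.ofReal_sub, ← Complex.ofReal_sub,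
    Complex.norm_real, Real.norm_eq_abs] at h1
  have h2 := le_of_abs_le h1
  have h3 := h.le_mean
  have h4 := h.integral_exp_le hM
  have h5 : 8 / τ ^ 2 * (∫ x, Real.exp (τ * |x|) ∂p) * s ^ 2 ≤ 8 / τ ^ 2 * M * s ^ 2 := by gcongr
  have h6 : mgf id p (-s) = ∫ x, Real.exp (-s * x) ∂p := rfl
  rw [h6] at h2
  nlinarith

/-- A strip around the imaginary axis in which `1 - complexMGF id p` vanishes only at `0`, with a
lower bound that is uniform over all admissible `p`. -/
lemma exists_strip (hτ : 0 < τ) (hM : 0 ≤ M) (hm : 0 < m) (hγ : 0 ≤ γ) (hγ1 : γ < 1) :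
    ∃ r c ρ : ℝ, 0 < r ∧ r ≤ 1 / 2 ∧ r ≤ τ / 2 ∧ 0 < c ∧ 0 ≤ ρ ∧ ρ < 1 ∧
      ∀ (p a b : Measure ℝ) (f : ℝ → ℝ), Admissible τ M m γ T B p a b f →
        (∀ z : ℂ, |z.re| ≤ r → c * min 1 ‖z‖ ≤ ‖1 - complexMGF id p z‖) ∧
        (∫⁻ x, ENNReal.ofReal (Real.exp (r * |x|)) ∂b ≤ ENNReal.ofReal ρ) ∧
        (∀ s : ℝ, 0 < s → s ≤ r → ∫⁻ x, ENNReal.ofReal (Real.exp (-s * x)) ∂p < 1) := by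
  set K := 8 / τ ^ 2 * M with hKdef
  set K₁ := 2 / τ * M with hK₁def
  have hK : 0 ≤ K := by positivity
  have hK₁ : 0 ≤ K₁ := by positivity
  set δ := min (τ / 2) (m / (2 * (K + 1))) with hδdef
  have hδ : 0 < δ := lt_min (by positivity) (by positivity)
  have hδτ : δ ≤ τ / 2 := min_le_left _ _
  have hKδ : K * δ ≤ m / 2 := by
    have h1 : δ ≤ m / (2 * (K + 1)) := min_le_right _ _
    rw [le_div_iff₀ (by positivity)] at h1
    nlinarith
  obtain ⟨c₀, hc₀, hc⟩ := exists_le_norm_one_sub_imaginary (τ := τ) (M := M) (m := m) (T := T)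
    (B := B) hτ hγ hγ1 (half_pos hδ)
  have hγ' : 0 < 1 - γ := sub_pos.2 hγ1
  set r := min (min (δ / 2) (1 / 2)) (min (c₀ / (2 * (K₁ + 1))) ((1 - γ) / (2 * (K₁ + 1))))
    with hrdef
  have hr : 0 < r := lt_min (lt_min (by positivity) (by positivity))
    (lt_min (by positivity) (by positivity))
  have hrδ : r ≤ δ / 2 := (min_le_left _ _).trans (min_le_left _ _)
  have hr1 : r ≤ 1 / 2 := (min_le_left _ _).trans (min_le_right _ _)
  have hrc : r * K₁ ≤ c₀ / 2 := by
    have h1 : r ≤ c₀ / (2 * (K₁ + 1)) := (min_le_right _ _).trans (min_le_left _ _)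
    rw [le_div_iff₀ (by positivity)] at h1
    nlinarith
  have hrγ : r * K₁ ≤ (1 - γ) / 2 := by
    have h1 : r ≤ (1 - γ) / (2 * (K₁ + 1)) := (min_le_right _ _).trans (min_le_right _ _)
    rw [le_div_iff₀ (by positivity)] at h1
    nlinarith
  refine ⟨r, min (m / 2) (c₀ / 2), (1 + γ) / 2, hr, hr1, by linarith,
    lt_min (by positivity) (by positivity), by linarith, by linarith, ?_⟩
  intro p a b f h
  have := h.prob
  have hMp := h.integral_exp_le hM
  have hI : 0 ≤ ∫ x, Real.exp (τ * |x|) ∂p := integral_nonneg fun x => Real.exp_nonneg _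
  refine ⟨fun z hz => ?_, ?_, fun s hs hsr => ?_⟩
  · rcases le_or_gt ‖z‖ δ with hzδ | hzδ
    · have h1 := norm_complexMGF_sub_le (z := z) hτ h.integrable_exp (by linarith)
      have h2 : mean p * ‖z‖ ≤ ‖1 - complexMGF id p z‖ + ‖complexMGF id p z - 1 - mean p * z‖ := by
        have h3 : ‖(mean p : ℂ) * z‖ = mean p * ‖z‖ := by
          rw [norm_mul, Complex.norm_real, Real.norm_of_nonneg (hm.le.trans h.le_mean)]
        have h7 := norm_add_le (1 - complexMGF id p z) (complexMGF id p z - 1 - mean p * z)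
        rwa [show (1 - complexMGF id p z) + (complexMGF id p z - 1 - mean p * z) =
          -(mean p * z) by ring, norm_neg, h3] at h7
      have h4 : 8 / τ ^ 2 * (∫ x, Real.exp (τ * |x|) ∂p) * ‖z‖ ^ 2 ≤ K * ‖z‖ ^ 2 := by
        rw [hKdef]; gcongr
      have h5 : K * ‖z‖ ^ 2 ≤ m / 2 * ‖z‖ := by
        have : K * ‖z‖ ≤ K * δ := by gcongr
        nlinarith [norm_nonneg z]
      have h6 : m * ‖z‖ ≤ mean p * ‖z‖ := by have := h.le_mean; gcongr
      calc min (m / 2) (c₀ / 2) * min 1 ‖z‖ ≤ m / 2 * ‖z‖ := by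
            gcongr
            · exact min_le_left _ _
            · exact min_le_right _ _
        _ ≤ _ := by linarith
    · have him : δ / 2 ≤ |z.im| := by
        have := Complex.norm_le_abs_re_add_abs_im z
        linarith
      have h1 := hc p a b f h z.im him
      have h2 := norm_complexMGF_sub_imaginary_le (z := z) hτ h.integrable_exp (by linarith)
      have h3 : |z.re| * (2 / τ * ∫ x, Real.exp (τ * |x|) ∂p) ≤ r * K₁ := by
        rw [hK₁def]; gcongr
      have h4 : ‖1 - complexMGF id p (z.im * I)‖ ≤
          ‖1 - complexMGF id p z‖ + ‖complexMGF id p z - complexMGF id p (z.im * I)‖ := by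
        rw [show 1 - complexMGF id p (z.im * I) = (1 - complexMGF id p z) +
          (complexMGF id p z - complexMGF id p (z.im * I)) by ring]
        exact norm_add_le _ _
      calc min (m / 2) (c₀ / 2) * min 1 ‖z‖ ≤ c₀ / 2 * 1 := by
            gcongr
            · exact min_le_right _ _
            · exact min_le_left _ _
        _ ≤ _ := by linarith
  · refine (h.lintegral_exp_right_le hτ hγ hM hr.le (by linarith)).trans
      (ENNReal.ofReal_le_ofReal ?_)
    rw [← hK₁def]
    linarith
  · refine h.lintegral_exp_neg_lt_one hτ hm hM hs (by linarith) ?_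
    rw [← hKdef]
    have : K * s ≤ K * δ := by gcongr; linarith
    linarith

end Admissible

end Renewal

/-! ### The density of the absolutely continuous component -/

namespace Renewal

open Filter Topology Complex ProbabilityTheory

section Density

variable {f : ℝ → ℝ} {ν : Measure ℝ} {s : ℝ}

lemma exists_le_mul_exp (hf : Continuous f) (hs : HasCompactSupport f) (s : ℝ) :
    ∃ C, ∀ x, ‖f x‖ ≤ C * Real.exp (s * x) := by
  have hc : Continuous fun x => f x * Real.exp (-(s * x)) := by fun_prop
  obtain ⟨C, hC⟩ := (hs.mul_right (f' := fun x => Real.exp (-(s * x)))).exists_bound_of_continuous hc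
  refine ⟨C, fun x => ?_⟩
  have h := hC x
  simp only [Pi.mul_apply, norm_mul, Real.norm_of_nonneg (Real.exp_nonneg _)] at h
  rwa [Real.exp_neg, ← div_eq_mul_inv, div_le_iff₀ (Real.exp_pos _)] at h

lemma integrable_exp_of_lintegral (hν : ∫⁻ x, ENNReal.ofReal (Real.exp (-s * x)) ∂ν < ∞) :
    Integrable (fun x => Real.exp (-s * x)) ν :=
  ⟨by fun_prop, by rwa [hasFiniteIntegral_iff_ofReal (ae_of_all _ fun x => Real.exp_nonneg _)]⟩

lemma integrable_comp_sub (hf : Continuous f) (hs : HasCompactSupport f)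
    (hν : ∫⁻ x, ENNReal.ofReal (Real.exp (-s * x)) ∂ν < ∞) (x : ℝ) :
    Integrable (fun y => f (x - y)) ν := by
  obtain ⟨C, hC⟩ := exists_le_mul_exp hf hs s
  refine ((integrable_exp_of_lintegral hν).const_mul (C * Real.exp (s * x))).mono'
    (by fun_prop) (ae_of_all _ fun y => (hC _).trans_eq ?_)
  rw [mul_assoc, ← Real.exp_add]
  congr 2; ring

lemma continuous_integral_comp_sub (hf : Continuous f) (hs : HasCompactSupport f)
    (hν : ∫⁻ x, ENNReal.ofReal (Real.exp (-s * x)) ∂ν < ∞) :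
    Continuous fun x => ∫ y, f (x - y) ∂ν := by
  obtain ⟨C, hC⟩ := exists_le_mul_exp hf hs s
  have hC0 : 0 ≤ C := by
    have h := (norm_nonneg _).trans (hC 0)
    simpa using h
  refine continuous_iff_continuousAt.2 fun x₀ => ?_
  refine continuousAt_of_dominated (bound := fun y => C * Real.exp (|s| * (|x₀| + 1)) *
    Real.exp (-s * y)) (Eventually.of_forall fun x => by fun_prop) ?_
    ((integrable_exp_of_lintegral hν).const_mul _) (ae_of_all _ fun y => by fun_prop)
  filter_upwards [Metric.ball_mem_nhds x₀ one_pos] with x hx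
  refine ae_of_all _ fun y => (hC _).trans ?_
  rw [mul_assoc, ← Real.exp_add]
  refine mul_le_mul_of_nonneg_left (Real.exp_le_exp.2 ?_) hC0
  have h1 : |x| ≤ |x₀| + 1 := by
    have h2 := abs_sub_abs_le_abs_sub x x₀
    rw [Metric.mem_ball, Real.dist_eq] at hx
    linarith
  have h3 : s * x ≤ |s| * (|x₀| + 1) := calc
    s * x ≤ |s * x| := le_abs_self _
    _ = |s| * |x| := abs_mul _ _
    _ ≤ _ := by gcongr
  linarith

lemma withDensity_conv [SFinite ν] {F : ℝ → ℝ≥0∞} (hF : Measurable F) :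
    Measure.conv (volume.withDensity F) ν =
      volume.withDensity fun x => ∫⁻ y, F (x - y) ∂ν := by
  refine Measure.ext_of_lintegral _ fun g hg => ?_
  have hm : Measurable fun x => ∫⁻ y, F (x - y) ∂ν :=
    Measurable.lintegral_prod_right' (f := fun q : ℝ × ℝ => F (q.1 - q.2)) (by fun_prop)
  have hm2 : Measurable fun x => ∫⁻ y, g (x + y) ∂ν :=
    Measurable.lintegral_prod_right' (f := fun q : ℝ × ℝ => g (q.1 + q.2)) (by fun_prop)
  rw [Measure.lintegral_conv hg, lintegral_withDensity_eq_lintegral_mul _ hF hm2,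
    lintegral_withDensity_eq_lintegral_mul _ hm hg]
  simp only [Pi.mul_apply]
  calc ∫⁻ x, F x * ∫⁻ y, g (x + y) ∂ν = ∫⁻ x, ∫⁻ y, F x * g (x + y) ∂ν := by
        refine lintegral_congr fun x => ?_
        rw [lintegral_const_mul _ (by fun_prop)]
    _ = ∫⁻ y, (∫⁻ x, F x * g (x + y)) ∂ν := lintegral_lintegral_swap
        (f := fun x y => F x * g (x + y)) (by fun_prop)
    _ = ∫⁻ y, (∫⁻ x, F (x - y) * g x) ∂ν := by
        refine lintegral_congr fun y => ?_
        rw [← lintegral_sub_right_eq_self (μ := volume) (fun x => F x * g (x + y)) y]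
        simp
    _ = ∫⁻ x, ∫⁻ y, F (x - y) * g x ∂ν := (lintegral_lintegral_swap
        (f := fun x y => F (x - y) * g x) (by fun_prop)).symm
    _ = _ := by
        refine lintegral_congr fun x => ?_
        rw [lintegral_mul_const _ (by fun_prop)]

/-- Convolving a measure with continuous compactly supported density produces a density given by a
genuine Bochner integral, provided the other factor has a finite exponential tilt. -/
lemma withDensity_ofReal_conv [SFinite ν] (hf : Continuous f) (h0 : ∀ x, 0 ≤ f x)
    (hs : HasCompactSupport f) (hν : ∫⁻ x, ENNReal.ofReal (Real.exp (-s * x)) ∂ν < ∞) :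
    Measure.conv (volume.withDensity fun x => ENNReal.ofReal (f x)) ν =
      volume.withDensity fun x => ENNReal.ofReal (∫ y, f (x - y) ∂ν) := by
  rw [withDensity_conv (by fun_prop)]
  congr 1; funext x
  rw [ofReal_integral_eq_lintegral_ofReal (integrable_comp_sub hf hs hν x)
    (ae_of_all _ fun y => h0 _)]

end Density

section Comparison

lemma max_eq_indicator (x : ℝ) :
    max 0 (1 - Real.exp (-x)) = (Ioi (0 : ℝ)).indicator (fun x => 1 - Real.exp (-x)) x := by
  by_cases hx : x ∈ Ioi (0 : ℝ)
  · rw [indicator_of_mem hx, max_eq_right]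
    have := Real.exp_le_one_iff.2 (neg_nonpos.2 (le_of_lt hx))
    linarith
  · rw [indicator_of_notMem hx, max_eq_left]
    have hx' : x ≤ 0 := not_lt.1 hx
    have := Real.one_le_exp (neg_nonneg.2 hx')
    linarith

lemma cexp_mul_max_eq (z : ℂ) : (fun x : ℝ => cexp (z * x) * (max 0 (1 - Real.exp (-x)) : ℝ)) =
    (Ioi (0 : ℝ)).indicator fun x : ℝ => cexp (z * x) - cexp ((z - 1) * x) := by
  funext x
  rw [max_eq_indicator]
  by_cases hx : x ∈ Ioi (0 : ℝ)
  · rw [indicator_of_mem hx, indicator_of_mem hx]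
    push_cast
    rw [mul_sub, mul_one, ← Complex.exp_add]
    congr 2; ring
  · rw [indicator_of_notMem hx, indicator_of_notMem hx]; simp

lemma integrable_cexp_mul_max {z : ℂ} (hz : z.re < 0) :
    Integrable fun x : ℝ => cexp (z * x) * (max 0 (1 - Real.exp (-x)) : ℝ) := by
  rw [cexp_mul_max_eq, integrable_indicator_iff measurableSet_Ioi]
  exact (integrableOn_exp_mul_complex_Ioi hz 0).sub
    (integrableOn_exp_mul_complex_Ioi (by simp; linarith) 0)

/-- The transform of `(1 - e^{-x})⁺`, which has the same simple pole at `0` as `-1/z`. -/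
lemma integral_cexp_mul_max {z : ℂ} (hz : z.re < 0) :
    ∫ x : ℝ, cexp (z * x) * (max 0 (1 - Real.exp (-x)) : ℝ) = -(1 / (z * (1 - z))) := by
  have hz1 : (z - 1).re < 0 := by simp; linarith
  have h0 : z ≠ 0 := by rintro rfl; simp at hz
  have h1 : z - 1 ≠ 0 := by intro h; rw [h] at hz1; simp at hz1
  have h2 : 1 - z ≠ 0 := by intro h; exact h1 (by linear_combination -h)
  rw [cexp_mul_max_eq, integral_indicator measurableSet_Ioi,
    integral_sub (integrableOn_exp_mul_complex_Ioi hz 0) (integrableOn_exp_mul_complex_Ioi hz1 0),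
    integral_exp_mul_complex_Ioi hz, integral_exp_mul_complex_Ioi hz1]
  simp only [ofReal_zero, mul_zero, Complex.exp_zero]
  field_simp
  ring

end Comparison

namespace Admissible

variable {τ M m γ T B r₀ c ρ : ℝ} {p a b : Measure ℝ} {f : ℝ → ℝ}

/-- The transform of the density minus its comparison function, with the singularity at `0`
removed by taking a divided difference. -/
noncomputable def transform (p a b : Measure ℝ) : ℂ → ℂ :=
  dslope (fun z => (mean p * (1 - z))⁻¹ -
    complexMGF id a z / ((1 - complexMGF id b z) * dslope (complexMGF id p) 0 z)) 0

lemma norm_complexMGF_right_le {z : ℂ}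
    (hb : ∫⁻ x, ENNReal.ofReal (Real.exp (r₀ * |x|)) ∂b ≤ ENNReal.ofReal ρ) (hρ : 0 ≤ ρ)
    (hz : |z.re| ≤ r₀) : ‖complexMGF id b z‖ ≤ ρ := by
  have h : ‖complexMGF id b z‖ₑ ≤ ENNReal.ofReal ρ := by
    refine (norm_complexMGF_le_toReal z).trans ((lintegral_mono fun x => ?_).trans hb)
    refine ENNReal.ofReal_le_ofReal (Real.exp_le_exp.2 ?_)
    calc z.re * x ≤ |z.re * x| := le_abs_self _
      _ = |z.re| * |x| := abs_mul _ _
      _ ≤ r₀ * |x| := by gcongr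
  rw [← ofReal_norm] at h
  exact (ENNReal.ofReal_le_ofReal_iff hρ).1 h

lemma one_sub_norm_le {w : ℂ} (hw : ‖w‖ ≤ ρ) : 1 - ρ ≤ ‖1 - w‖ := by
  have h := norm_sub_norm_le (1 : ℂ) w
  rw [norm_one] at h
  linarith

lemma complexMGF_zero_eq (μ : Measure ℝ) : complexMGF id μ 0 = μ.real univ := by
  simp [complexMGF]

lemma differentiableOn_transform (h : Admissible τ M m γ T B p a b f) (hτ : 0 < τ) (hm : 0 < m)
    (hr₀ : 0 < r₀) (hr₀1 : r₀ ≤ 1 / 2) (hr₀τ : r₀ ≤ τ) (hc : 0 < c) (hρ : 0 ≤ ρ) (hρ1 : ρ < 1)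
    (hp : ∀ z : ℂ, |z.re| ≤ r₀ → c * min 1 ‖z‖ ≤ ‖1 - complexMGF id p z‖)
    (hb : ∫⁻ x, ENNReal.ofReal (Real.exp (r₀ * |x|)) ∂b ≤ ENNReal.ofReal ρ) :
    DifferentiableOn ℂ (transform p a b) {z | |z.re| < r₀} := by
  have := h.prob
  have hopen : IsOpen {z : ℂ | |z.re| < r₀} :=
    isOpen_lt (by fun_prop) continuous_const
  have hmem : {z : ℂ | |z.re| < r₀} ∈ 𝓝 (0 : ℂ) := hopen.mem_nhds (by simpa using hr₀)
  have hsub : {z : ℂ | |z.re| < r₀} ⊆ {z : ℂ | |z.re| < τ} := fun z hz =>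
    lt_of_lt_of_le (show |z.re| < r₀ from hz) hr₀τ
  have hpi := h.integrable_exp
  have hpd := (differentiableOn_complexMGF_strip hpi).mono hsub
  have had := (differentiableOn_complexMGF_strip (hpi.mono_measure h.le_left)).mono hsub
  have hbd := (differentiableOn_complexMGF_strip (hpi.mono_measure h.le_right)).mono hsub
  have hmean : (mean p : ℂ) ≠ 0 := by
    have := h.le_mean
    exact_mod_cast (by linarith : mean p ≠ 0)
  refine (Complex.differentiableOn_dslope hmem).2 (DifferentiableOn.sub ?_ (had.div ?_ ?_))
  · refine DifferentiableOn.inv (by fun_prop) fun z hz => mul_ne_zero hmean ?_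
    intro hz1
    have h1 : (1 - z).re = 0 := by rw [hz1]; simp
    have h2 := (abs_lt.1 (show |z.re| < r₀ from hz)).2
    simp only [sub_re, one_re] at h1
    linarith
  · exact ((differentiableOn_const _).sub hbd).mul ((Complex.differentiableOn_dslope hmem).2 hpd)
  · intro z hz
    have hz' : |z.re| ≤ r₀ := le_of_lt hz
    refine mul_ne_zero ?_ ?_
    · have h1 := one_sub_norm_le (norm_complexMGF_right_le hb hρ hz')
      exact norm_pos_iff.1 (by linarith)
    · by_cases hz0 : z = 0
      · rw [hz0, dslope_same, (hasDerivAt_complexMGF_zero hτ hpi).deriv]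
        exact hmean
      · rw [dslope_of_ne _ hz0, slope_def_field]
        have h1 := hp z hz'
        have h2 : 0 < c * min 1 ‖z‖ := mul_pos hc (lt_min one_pos (norm_pos_iff.2 hz0))
        refine div_ne_zero ?_ (by simpa using hz0)
        rw [complexMGF_zero_eq, probReal_univ, ofReal_one, ← neg_sub, neg_ne_zero]
        exact norm_pos_iff.1 (h2.trans_le h1)

lemma transform_apply (h : Admissible τ M m γ T B p a b f) (hτ : 0 < τ) (hm : 0 < m)
    (hr₀ : 0 < r₀) (hρ : 0 ≤ ρ) (hρ1 : ρ < 1)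
    (hb : ∫⁻ x, ENNReal.ofReal (Real.exp (r₀ * |x|)) ∂b ≤ ENNReal.ofReal ρ) {z : ℂ} (hz : z ≠ 0) :
    transform p a b z = (mean p : ℂ)⁻¹ * (1 / (z * (1 - z))) +
      complexMGF id a z * ((1 - complexMGF id b z)⁻¹ * (1 - complexMGF id p z)⁻¹) := by
  have := h.prob
  have hmean : (mean p : ℂ) ≠ 0 := by
    have := h.le_mean
    exact_mod_cast (by linarith : mean p ≠ 0)
  have hb1 := one_sub_norm_le (norm_complexMGF_right_le (z := 0) hb hρ (by simpa using hr₀.le))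
  have hb0 : (1 - complexMGF id b 0 : ℂ) ≠ 0 := norm_pos_iff.1 (by linarith)
  have hab : complexMGF id a 0 = 1 - complexMGF id b 0 := by
    have h1 := h.complexMGF_add (z := 0) (by simpa using hτ.le)
    rw [complexMGF_zero_eq p, probReal_univ, ofReal_one] at h1
    rw [h1]; ring
  unfold transform
  rw [dslope_of_ne _ hz, slope_def_field, dslope_of_ne _ hz, slope_def_field, dslope_same,
    (hasDerivAt_complexMGF_zero hτ h.integrable_exp).deriv, hab, complexMGF_zero_eq p,
    probReal_univ, ofReal_one, ← neg_sub (1 : ℂ) (complexMGF id p z)]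
  simp only [sub_zero, mul_one]
  rw [div_mul_cancel_left₀ hb0, sub_self, sub_zero, neg_div, mul_neg, div_neg, sub_neg_eq_add]
  simp only [div_eq_mul_inv, mul_inv, inv_inv, one_mul]
  field_simp

/-- The bound for the transform of the density in the strip. -/
lemma norm_transform_le (h : Admissible τ M m γ T B p a b f) (hτ : 0 < τ) (hm : 0 < m)
    (hr₀1 : r₀ ≤ 1 / 2) (hc : 0 < c) (hρ : 0 ≤ ρ) (hρ1 : ρ < 1)
    (hp : ∀ z : ℂ, |z.re| ≤ r₀ → c * min 1 ‖z‖ ≤ ‖1 - complexMGF id p z‖)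
    (hb : ∫⁻ x, ENNReal.ofReal (Real.exp (r₀ * |x|)) ∂b ≤ ENNReal.ofReal ρ) {r : ℝ} (hr : 0 < r)
    (hrr : r ≤ r₀) {z : ℂ} (hz : |z.re| ≤ r) (hrz : r ≤ ‖z‖) :
    ‖transform p a b z‖ ≤
      (m⁻¹ + Real.exp (r₀ * |T|) * |B| * ((1 - ρ)⁻¹ * (c * r)⁻¹)) / ‖z‖ ^ 2 := by
  have hzn : 0 < ‖z‖ := hr.trans_le hrz
  have hz0 : z ≠ 0 := norm_pos_iff.1 hzn
  have hmean : 0 < mean p := hm.trans_le h.le_mean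
  have hz' : |z.re| ≤ r₀ := hz.trans hrr
  rw [transform_apply h hτ hm (hr.trans_le hrr) hρ hρ1 hb hz0, add_div]
  refine (norm_add_le _ _).trans (add_le_add ?_ ?_)
  · have h1 : ‖z‖ ≤ ‖1 - z‖ := by
      rw [← sq_le_sq₀ hzn.le (norm_nonneg _), Complex.sq_norm, Complex.sq_norm,
        Complex.normSq_apply, Complex.normSq_apply]
      have := (abs_le.1 hz').2
      simp only [sub_re, one_re, sub_im, one_im]
      nlinarith
    rw [norm_mul, norm_inv, Complex.norm_real, Real.norm_of_nonneg hmean.le, norm_div, norm_one,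
      norm_mul, ← div_eq_mul_one_div, sq]
    have := h.le_mean
    gcongr
  · have h1 := one_sub_norm_le (norm_complexMGF_right_le hb hρ hz')
    have h2 := h.norm_complexMGF_left_le hz0
    have h3 : c * r ≤ ‖1 - complexMGF id p z‖ := by
      refine le_trans ?_ (hp z hz')
      gcongr
      exact le_min (by linarith) hrz
    have h4 : Real.exp (|z.re| * |T|) * B / ‖z‖ ^ 2 ≤ Real.exp (r₀ * |T|) * |B| / ‖z‖ ^ 2 := by
      have h5 := Real.exp_le_exp.2 (mul_le_mul_of_nonneg_right hz' (abs_nonneg T))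
      refine div_le_div_of_nonneg_right ?_ (by positivity)
      exact (mul_le_mul_of_nonneg_left (le_abs_self B) (Real.exp_nonneg _)).trans
        (mul_le_mul_of_nonneg_right h5 (abs_nonneg B))
    rw [norm_mul, norm_mul, norm_inv, norm_inv, mul_div_right_comm]
    have := sub_pos.2 hρ1
    gcongr
    exact h2.trans h4

/-- The measure against which the density of the absolutely continuous component is averaged has
a finite exponential tilt. -/
lemma lintegral_exp_conv_lt_top (h : Admissible τ M m γ T B p a b f) {s : ℝ}
    (hp : ∫⁻ x, ENNReal.ofReal (Real.exp (s * x)) ∂p < 1) :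
    ∫⁻ x, ENNReal.ofReal (Real.exp (s * x))
      ∂(Measure.conv (renewalMeasure b) (renewalMeasure p)) < ∞ := by
  have := h.prob
  have := h.isFiniteMeasure_right
  refine (lintegral_conv_le _ _ (by fun_prop) (ofReal_exp_add_le s)).trans_lt
    (ENNReal.mul_lt_top ?_ (lintegral_exp_renewalMeasure_lt_top p hp))
  exact lintegral_exp_renewalMeasure_lt_top b ((lintegral_mono' h.le_right le_rfl).trans_lt hp)

/-- The density approaches the renewal density `(mean p)⁻¹` on the right and `0` on the left, with
constants depending only on the parameters. -/
lemma abs_density_sub_le (h : Admissible τ M m γ T B p a b f) (hτ : 0 < τ) (hm : 0 < m)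
    (hr₀1 : r₀ ≤ 1 / 2) (hr₀τ : r₀ ≤ τ) (hc : 0 < c) (hρ : 0 ≤ ρ) (hρ1 : ρ < 1)
    (hp : ∀ z : ℂ, |z.re| ≤ r₀ → c * min 1 ‖z‖ ≤ ‖1 - complexMGF id p z‖)
    (hb : ∫⁻ x, ENNReal.ofReal (Real.exp (r₀ * |x|)) ∂b ≤ ENNReal.ofReal ρ) {r : ℝ} (hr : 0 < r)
    (hrr : r < r₀) (hpr : ∫⁻ x, ENNReal.ofReal (Real.exp (-r * x)) ∂p < 1) (x : ℝ) :
    let q : ℝ → ℝ := fun x => (∫ y, f (x - y)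
      ∂(Measure.conv (renewalMeasure b) (renewalMeasure p))) -
        (mean p)⁻¹ * max 0 (1 - Real.exp (-x))
    let K := m⁻¹ + Real.exp (r₀ * |T|) * |B| * ((1 - ρ)⁻¹ * (c * r)⁻¹)
    |q x| ≤ K / r ^ 2 / 2 * Real.exp (r * x) ∧ |q x| ≤ K / r ^ 2 / 2 * Real.exp (-r * x) := by
  intro q K
  have := h.prob
  have := h.isFiniteMeasure_right
  have := h.isFiniteMeasure_left
  set ν := Measure.conv (renewalMeasure b) (renewalMeasure p) with hνdef
  have hν : ∫⁻ x, ENNReal.ofReal (Real.exp (-r * x)) ∂ν < ∞ := h.lintegral_exp_conv_lt_top hpr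
  have hfc := h.contDiff.continuous
  set g : ℝ → ℝ := fun x => ∫ y, f (x - y) ∂ν with hg
  have hgc : Continuous g := continuous_integral_comp_sub hfc h.hasCompactSupport hν
  have hg0 : ∀ x, 0 ≤ g x := fun x => integral_nonneg fun y => h.nonneg _
  have hconv : Measure.conv a ν = volume.withDensity fun x => ENNReal.ofReal (g x) := by
    rw [h.density]
    exact withDensity_ofReal_conv hfc h.nonneg h.hasCompactSupport hν
  have hρ' := sub_pos.2 hρ1
  have hgi : ∀ z : ℂ, z.re = -r → Integrable fun x : ℝ => cexp (z * x) * g x := fun z hz => by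
    have h1 : ∫⁻ x, ENNReal.ofReal (Real.exp (z.re * x)) ∂(Measure.conv a ν) < ∞ := by
      rw [hz]
      refine (lintegral_conv_le _ _ (by fun_prop) (ofReal_exp_add_le _)).trans_lt
        (ENNReal.mul_lt_top ?_ hν)
      exact ((lintegral_mono' h.le_left le_rfl).trans_lt hpr).trans ENNReal.one_lt_top
    have h2 := integrable_cexp_mul h1
    rw [hconv, integrable_withDensity_iff_integrable_smul' (by fun_prop) (by simp)] at h2
    refine h2.congr (ae_of_all _ fun x => ?_)
    simp only [ENNReal.toReal_ofReal (hg0 x), real_smul]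
    rw [mul_comm]
  have hgt : ∀ z : ℂ, z.re = -r → ∫ x : ℝ, cexp (z * x) * g x =
      complexMGF id a z * ((1 - complexMGF id b z)⁻¹ * (1 - complexMGF id p z)⁻¹) := fun z hz => by
    rw [← complexMGF_withDensity hgc.measurable hg0, ← hconv, complexMGF_conv, hνdef, complexMGF_conv,
      complexMGF_renewalMeasure p (by rw [hz]; exact hpr), complexMGF_renewalMeasure b]
    rw [hz]
    exact (lintegral_mono' h.le_right le_rfl).trans_lt hpr
  have hsplit : ∀ z : ℂ, (fun x : ℝ => cexp (z * x) * (q x : ℝ)) = fun x : ℝ =>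
      cexp (z * x) * g x -
        (mean p : ℂ)⁻¹ * (cexp (z * x) * (max 0 (1 - Real.exp (-x)) : ℝ)) := fun z => by
    funext x
    simp only [q, ofReal_sub, ofReal_mul, ofReal_inv]
    ring
  have hqi : ∀ z : ℂ, z.re = -r → Integrable fun x : ℝ => cexp (z * x) * (q x : ℝ) := fun z hz => by
    rw [hsplit]
    exact (hgi z hz).sub ((integrable_cexp_mul_max (by linarith)).const_mul _)
  refine abs_le_of_transform (G := transform p a b) (r₀ := r₀) hr (by linarith) hrr ?_
    (h.differentiableOn_transform hτ hm (hr.trans hrr) hr₀1 hr₀τ hc hρ hρ1 hp hb)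
    (fun z hz hrz => h.norm_transform_le hτ hm hr₀1 hc hρ hρ1 hp hb hr hrr.le hz hrz) ?_ ?_ ?_ x
  · positivity
  · have : Continuous fun x => g x - (mean p)⁻¹ * max 0 (1 - Real.exp (-x)) := by fun_prop
    exact this
  · have h1 := (hqi ((-r : ℝ) : ℂ) (by simp)).re
    refine h1.congr (ae_of_all _ fun x => ?_)
    simp only [RCLike.re_eq_complex_re]
    rw [← Complex.ofReal_mul, ← Complex.ofReal_exp, ← Complex.ofReal_mul, Complex.ofReal_re]
  · intro z hz
    have hz0 : z ≠ 0 := by rintro rfl; simp at hz; linarith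
    rw [hsplit, integral_sub (hgi z hz) ((integrable_cexp_mul_max (by linarith)).const_mul _),
      integral_const_mul, integral_cexp_mul_max (by linarith), hgt z hz,
      transform_apply h hτ hm (hr.trans hrr) hρ hρ1 hb hz0]
    ring

end Admissible

end Renewal

/-! ### Consequences for uniform families -/

namespace Renewal

open Filter Topology ProbabilityTheory

/-- The density of the absolutely continuous component of the renewal measure of
`p = a + b`, where `f` is the density of `a`. -/
noncomputable def renewalDensity (p b : Measure ℝ) (f : ℝ → ℝ) (x : ℝ) : ℝ :=
  ∫ y, f (x - y) ∂(Measure.conv (renewalMeasure b) (renewalMeasure p))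

namespace Admissible

variable {τ M m γ T B r₀ c ρ : ℝ} {p a b : Measure ℝ} {f : ℝ → ℝ}

lemma renewalDensity_nonneg (h : Admissible τ M m γ T B p a b f) (x : ℝ) : 0 ≤ renewalDensity p b f x :=
  integral_nonneg fun _ => h.nonneg _

lemma continuous_renewalDensity (h : Admissible τ M m γ T B p a b f) {s : ℝ}
    (hs : ∫⁻ x, ENNReal.ofReal (Real.exp (-s * x)) ∂p < 1) : Continuous (renewalDensity p b f) :=
  continuous_integral_comp_sub h.contDiff.continuous h.hasCompactSupport
    (h.lintegral_exp_conv_lt_top hs)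

lemma renewalMeasure_eq (h : Admissible τ M m γ T B p a b f) {s : ℝ}
    (hs : ∫⁻ x, ENNReal.ofReal (Real.exp (-s * x)) ∂p < 1) :
    renewalMeasure p =
      volume.withDensity (fun x => ENNReal.ofReal (renewalDensity p b f x)) + renewalMeasure b := by
  have := h.prob
  have := h.isFiniteMeasure_left
  have := h.isFiniteMeasure_right
  have h1 := withDensity_ofReal_conv h.contDiff.continuous h.nonneg h.hasCompactSupport
    (h.lintegral_exp_conv_lt_top hs)
  rw [← h.density] at h1
  unfold renewalDensity
  rw [← h1]
  conv_lhs => rw [h.add]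
  rw [renewalMeasure_add a b, ← h.add]

lemma renewalMeasure_right_univ_le (h : Admissible τ M m γ T B p a b f) :
    renewalMeasure b univ ≤ (1 - ENNReal.ofReal γ)⁻¹ := by
  have := h.isFiniteMeasure_right
  have h1 := lintegral_renewalMeasure_le b (g := fun _ => 1) (by fun_prop) (by simp) le_rfl
  simp only [lintegral_const, one_mul] at h1
  refine h1.trans (ENNReal.inv_le_inv.2 (tsub_le_tsub_left h.univ_le _))

/-- Markov's inequality for the tails of the finite part. -/
lemma mul_tail_le (h : Admissible τ M m γ T B p a b f)
    (hb : ∫⁻ x, ENNReal.ofReal (Real.exp (r₀ * |x|)) ∂b ≤ ENNReal.ofReal ρ) (hr₀ : 0 ≤ r₀) (x : ℝ) :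
    ENNReal.ofReal (Real.exp (r₀ * x)) * renewalMeasure b (Iic (-x) ∪ Ici x) ≤
      (1 - ENNReal.ofReal ρ)⁻¹ := by
  have := h.isFiniteMeasure_right
  have h1 := lintegral_renewalMeasure_le b (g := fun x => ENNReal.ofReal (Real.exp (r₀ * |x|)))
    (by fun_prop) (fun x y => by
      rw [← ENNReal.ofReal_mul (Real.exp_nonneg _), ← Real.exp_add, ← mul_add]
      exact ENNReal.ofReal_le_ofReal (Real.exp_le_exp.2
        (mul_le_mul_of_nonneg_left (abs_add_le x y) hr₀))) (by simp)
  refine le_trans ?_ (h1.trans (ENNReal.inv_le_inv.2 (tsub_le_tsub_left hb _)))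
  refine le_trans ?_ (mul_meas_ge_le_lintegral (by fun_prop) (ENNReal.ofReal (Real.exp (r₀ * x))))
  gcongr
  intro y hy
  refine ENNReal.ofReal_le_ofReal (Real.exp_le_exp.2 (mul_le_mul_of_nonneg_left ?_ hr₀))
  rcases hy with hy | hy
  · exact (le_neg_of_le_neg hy).trans (neg_le_abs y)
  · exact (show x ≤ y from hy).trans (le_abs_self y)

end Admissible

section Family

variable {ι : Type*} {p Φ Ψ : ι → Measure ℝ} {φ : ι → ℝ → ℝ} {lam : ι → ℝ}

/-- A uniform family is admissible with common parameters. -/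
lemma IsUniformFamily.exists_admissible (h : IsUniformFamily p Φ Ψ φ lam) :
    ∃ τ M m γ T B : ℝ, 0 < τ ∧ 0 ≤ M ∧ 0 < m ∧ 0 ≤ γ ∧ γ < 1 ∧ ∀ i,
      Admissible τ M m γ T B (p i) (ENNReal.ofReal (1 - lam i) • Φ i)
        (ENNReal.ofReal (lam i) • Ψ i) (fun x => (1 - lam i) * φ i x) := by
  obtain ⟨τ, hτ, hM⟩ := h.exp_moment
  obtain ⟨m, hm, hmean⟩ := h.mean_pos
  obtain ⟨γ, hγ, hlam⟩ := h.lam_lt_one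
  obtain ⟨T, hT, hφ, B, hB⟩ := h.smooth
  refine ⟨τ, _, m, max γ 0, T, B, hτ, ENNReal.toReal_nonneg
    (a := ⨆ i, ∫⁻ x, ENNReal.ofReal (Real.exp (τ * |x|)) ∂(p i)), hm, le_max_right _ _,
    max_lt hγ one_pos, fun i => ?_⟩
  have := h.prob_Ψ i
  have hl0 := h.lam_nonneg i
  have hl1 : 0 ≤ 1 - lam i := by have := hlam i; linarith
  have hφc := (hφ i).1
  refine ⟨h.prob_p i, h.mixture i, ?_, fun x => mul_nonneg hl1 (h.density_nonneg i x), ?_,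
    contDiff_const.mul hφc, ?_, ?_, hmean i, ?_⟩
  · rw [Measure.smul_apply, measure_univ, smul_eq_mul, mul_one]
    exact ENNReal.ofReal_le_ofReal ((hlam i).trans (le_max_left _ _))
  · have hφm : Measurable (φ i) := hφc.continuous.measurable
    rw [h.density i, ← withDensity_smul _ (by fun_prop)]
    congr 1; funext x
    rw [Pi.smul_apply, smul_eq_mul, ENNReal.ofReal_mul hl1]
  · exact (tsupport_mul_subset_right (f := fun _ => 1 - lam i)).trans (hφ i).2.2
  · have hd : ∀ x, iteratedDeriv 2 (fun x => (1 - lam i) * φ i x) x =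
        (1 - lam i) * iteratedDeriv 2 (φ i) x := fun x =>
      iteratedDeriv_const_mul_field _ _
    simp only [hd, abs_mul, abs_of_nonneg hl1]
    rw [intervalIntegral.integral_const_mul]
    have h0 : 0 ≤ ∫ x in (-T)..T, |iteratedDeriv 2 (φ i) x| :=
      intervalIntegral.integral_nonneg (by linarith) fun x _ => abs_nonneg _
    have := hB i
    nlinarith
  · rw [ENNReal.ofReal_toReal hM.ne]
    exact le_iSup (fun i => ∫⁻ x, ENNReal.ofReal (Real.exp (τ * |x|)) ∂(p i)) i

lemma IsUniformFamily.finitePart_eq (h : IsUniformFamily p Φ Ψ φ lam) (i : ι) :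
    finitePart (Ψ i) (lam i) = renewalMeasure (ENNReal.ofReal (lam i) • Ψ i) :=
  have := h.prob_Ψ i
  finitePart_eq_renewalMeasure _ (h.lam_nonneg i)

lemma IsUniformFamily.acDensity_eq (h : IsUniformFamily p Φ Ψ φ lam) (i : ι) :
    acDensity (p i) (Ψ i) (φ i) (lam i) =
      renewalDensity (p i) (ENNReal.ofReal (lam i) • Ψ i) (fun x => (1 - lam i) * φ i x) := by
  funext x
  rw [acDensity, renewalDensity, h.finitePart_eq, integral_const_mul]

lemma IsUniformFamily.finitePart_univ_lt_top (h : IsUniformFamily p Φ Ψ φ lam) :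
    (⨆ i, finitePart (Ψ i) (lam i) univ) < ∞ := by
  obtain ⟨τ, M, m, γ, T, B, -, -, -, hγ, hγ1, hadm⟩ := h.exists_admissible
  refine lt_of_le_of_lt (iSup_le fun i => ?_) (b := (1 - ENNReal.ofReal γ)⁻¹) ?_
  · rw [h.finitePart_eq]
    exact (hadm i).renewalMeasure_right_univ_le
  · rw [ENNReal.inv_lt_top]
    exact tsub_pos_of_lt (ENNReal.ofReal_lt_one.2 hγ1)

/-- Tilting the members of a uniform family by `e^{-sx}`, with `s > 0` small, gives
subprobability measures. -/
lemma IsUniformFamily.exists_tilt (h : IsUniformFamily p Φ Ψ φ lam) :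
    ∃ s₀ : ℝ, 0 < s₀ ∧ ∀ i, ∀ s, 0 < s → s ≤ s₀ →
      ∫⁻ x, ENNReal.ofReal (Real.exp (-s * x)) ∂(p i) < 1 := by
  obtain ⟨τ, M, m, γ, T, B, hτ, hM, hm, hγ, hγ1, hadm⟩ := h.exists_admissible
  obtain ⟨r, c, ρ, hr, -, -, -, -, -, hall⟩ :=
    Admissible.exists_strip (T := T) (B := B) hτ hM hm hγ hγ1
  exact ⟨r, hr, fun i => (hall _ _ _ _ (hadm i)).2.2⟩

/-- Exponential decay of the density at both ends and of the tails of the finite part, at some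
common rate. -/
lemma IsUniformFamily.exists_rate (h : IsUniformFamily p Φ Ψ φ lam) :
    ∃ r₀ : ℝ, 0 < r₀ ∧ ∀ r : ℝ, 0 < r → r < r₀ →
      boundA₁ p Ψ φ lam r < ∞ ∧ boundA₂ Ψ lam r < ∞ := by
  obtain ⟨τ, M, m, γ, T, B, hτ, hM, hm, hγ, hγ1, hadm⟩ := h.exists_admissible
  obtain ⟨r₀, c, ρ, hr₀, hr₀1, hr₀τ, hc, hρ, hρ1, hall⟩ :=
    Admissible.exists_strip (T := T) (B := B) hτ hM hm hγ hγ1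
  refine ⟨r₀, hr₀, fun r hr hrr => ?_⟩
  set K := (m⁻¹ + Real.exp (r₀ * |T|) * |B| * ((1 - ρ)⁻¹ * (c * r)⁻¹)) / r ^ 2 / 2 with hK
  have key : ∀ i x, |acDensity (p i) (Ψ i) (φ i) (lam i) x -
      (mean (p i))⁻¹ * max 0 (1 - Real.exp (-x))| ≤ K * Real.exp (r * x) ∧
      |acDensity (p i) (Ψ i) (φ i) (lam i) x -
      (mean (p i))⁻¹ * max 0 (1 - Real.exp (-x))| ≤ K * Real.exp (-r * x) := fun i x => by
    obtain ⟨h1, h2, h3⟩ := hall _ _ _ _ (hadm i)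
    have h4 := (hadm i).abs_density_sub_le hτ hm hr₀1 (by linarith) hc hρ hρ1 h1 h2 hr hrr
      (h3 r hr hrr.le) x
    rw [h.acDensity_eq]
    exact h4
  have hmean : ∀ i, 0 < (mean (p i))⁻¹ ∧ (mean (p i))⁻¹ ≤ m⁻¹ := fun i =>
    ⟨inv_pos.2 (hm.trans_le (hadm i).le_mean), inv_anti₀ hm (hadm i).le_mean⟩
  refine ⟨ENNReal.add_lt_top.2 ⟨?_, ?_⟩, ?_⟩
  · refine lt_of_le_of_lt (iSup_le fun i => iSup_le fun x => iSup_le fun hx => ?_)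
      (ENNReal.ofReal_lt_top (r := K + m⁻¹))
    refine ENNReal.ofReal_le_ofReal ?_
    obtain ⟨hm0, hm1⟩ := hmean i
    have h1 := (key i x).2
    have h2 : 0 ≤ 1 - Real.exp (-x) := by
      have := Real.exp_le_one_iff.2 (neg_nonpos.2 hx.le)
      linarith
    rw [max_eq_right h2] at h1
    have h3 : |acDensity (p i) (Ψ i) (φ i) (lam i) x - (mean (p i))⁻¹| ≤
        K * Real.exp (-r * x) + m⁻¹ * Real.exp (-x) := by
      have h4 := abs_sub_le (acDensity (p i) (Ψ i) (φ i) (lam i) x)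
        ((mean (p i))⁻¹ * (1 - Real.exp (-x))) (mean (p i))⁻¹
      have h5 : |(mean (p i))⁻¹ * (1 - Real.exp (-x)) - (mean (p i))⁻¹| ≤ m⁻¹ * Real.exp (-x) := by
        rw [show (mean (p i))⁻¹ * (1 - Real.exp (-x)) - (mean (p i))⁻¹ =
          -((mean (p i))⁻¹ * Real.exp (-x)) by ring, abs_neg, abs_of_nonneg (by positivity)]
        gcongr
      linarith
    have h6 : Real.exp (r * x) * Real.exp (-r * x) = 1 := by
      rw [← Real.exp_add, neg_mul, add_neg_cancel, Real.exp_zero]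
    have h7 : Real.exp (r * x) * Real.exp (-x) ≤ 1 := by
      rw [← Real.exp_add, Real.exp_le_one_iff]
      nlinarith
    have hm' : 0 < m⁻¹ := inv_pos.2 hm
    calc Real.exp (r * x) * |acDensity (p i) (Ψ i) (φ i) (lam i) x - (mean (p i))⁻¹|
        ≤ Real.exp (r * x) * (K * Real.exp (-r * x) + m⁻¹ * Real.exp (-x)) := by gcongr
      _ = K * (Real.exp (r * x) * Real.exp (-r * x)) +
          m⁻¹ * (Real.exp (r * x) * Real.exp (-x)) := by ring
      _ ≤ K * 1 + m⁻¹ * 1 := by rw [h6]; gcongr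
      _ = K + m⁻¹ := by ring
  · refine lt_of_le_of_lt (iSup_le fun i => iSup_le fun x => iSup_le fun hx => ?_)
      (ENNReal.ofReal_lt_top (r := K))
    refine ENNReal.ofReal_le_ofReal ?_
    have h1 := (key i (-x)).1
    have h2 : 1 - Real.exp (- -x) ≤ 0 := by
      have := Real.one_le_exp (x := - -x) (by linarith)
      linarith
    rw [max_eq_left h2, mul_zero, sub_zero] at h1
    have h6 : Real.exp (r * x) * Real.exp (r * -x) = 1 := by
      rw [← Real.exp_add, ← mul_add, add_neg_cancel, mul_zero, Real.exp_zero]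
    calc Real.exp (r * x) * acDensity (p i) (Ψ i) (φ i) (lam i) (-x)
        ≤ Real.exp (r * x) * (K * Real.exp (r * -x)) := by
          gcongr
          exact (le_abs_self _).trans h1
      _ = K := by rw [mul_left_comm, h6, mul_one]
  · refine lt_of_le_of_lt (iSup_le fun i => iSup_le fun x => iSup_le fun hx => ?_)
      (b := (1 - ENNReal.ofReal ρ)⁻¹) ?_
    · rw [h.finitePart_eq]
      refine le_trans ?_ ((hadm i).mul_tail_le (hall _ _ _ _ (hadm i)).2.1 hr₀.le x)
      gcongr
    · rw [ENNReal.inv_lt_top]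
      exact tsub_pos_of_lt (ENNReal.ofReal_lt_one.2 hρ1)

end Family

end Renewal

/-! ### Existence and uniqueness for the renewal equation -/

namespace Renewal

open Filter Topology ProbabilityTheory

variable {p : Measure ℝ} {z : ℝ → ℝ} {L η s s₀ : ℝ}

lemma exp_neg_mul_abs_le (hη : s ≤ η) (hs : 0 ≤ s) (x : ℝ) :
    Real.exp (-η * |x|) ≤ Real.exp (s * x) := by
  refine Real.exp_le_exp.2 ?_
  have h1 := neg_abs_le x
  nlinarith [abs_nonneg x]

lemma abs_comp_sub_le (hL : 0 ≤ L) (hz : ∀ x, |z x| ≤ L * Real.exp (-η * |x|)) (hη : s ≤ η)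
    (hs : 0 ≤ s) (x y : ℝ) : |z (x - y)| ≤ L * Real.exp (s * x) * Real.exp (-s * y) := by
  refine (hz _).trans ?_
  rw [mul_assoc, ← Real.exp_add, show s * x + -s * y = s * (x - y) by ring]
  exact mul_le_mul_of_nonneg_left (exp_neg_mul_abs_le hη hs _) hL

/-- The solution `∫ z(x - y) N_p(dy)` of the renewal equation. -/
noncomputable def renewalSolution (p : Measure ℝ) (z : ℝ → ℝ) (x : ℝ) : ℝ :=
  ∫ y, z (x - y) ∂(renewalMeasure p)

lemma integrable_exp_renewalMeasure [SFinite p]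
    (hp : ∫⁻ x, ENNReal.ofReal (Real.exp (-s * x)) ∂p < 1) :
    Integrable (fun x => Real.exp (-s * x)) (renewalMeasure p) :=
  integrable_exp_of_lintegral (lintegral_exp_renewalMeasure_lt_top p hp)

lemma integrable_comp_sub_renewalMeasure [SFinite p] (hzm : Measurable z) (hL : 0 ≤ L)
    (hz : ∀ x, |z x| ≤ L * Real.exp (-η * |x|)) (hη : s ≤ η) (hs : 0 ≤ s)
    (hp : ∫⁻ x, ENNReal.ofReal (Real.exp (-s * x)) ∂p < 1) (x : ℝ) :
    Integrable (fun y => z (x - y)) (renewalMeasure p) :=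
  ((integrable_exp_renewalMeasure hp).const_mul (L * Real.exp (s * x))).mono'
    (hzm.comp (measurable_const.sub measurable_id)).aestronglyMeasurable
    (ae_of_all _ fun y => abs_comp_sub_le hL hz hη hs x y)

lemma measurable_renewalSolution [SFinite p] (hzm : Measurable z) :
    Measurable (renewalSolution p z) := by
  have h : StronglyMeasurable fun q : ℝ × ℝ => z (q.1 - q.2) :=
    (by fun_prop : Measurable fun q : ℝ × ℝ => z (q.1 - q.2)).stronglyMeasurable
  exact h.integral_prod_right'.measurable

lemma abs_renewalSolution_le [SFinite p] (hL : 0 ≤ L)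
    (hz : ∀ x, |z x| ≤ L * Real.exp (-η * |x|)) (hη : s ≤ η) (hs : 0 ≤ s)
    (hp : ∫⁻ x, ENNReal.ofReal (Real.exp (-s * x)) ∂p < 1) (x : ℝ) :
    |renewalSolution p z x| ≤
      L * (∫ y, Real.exp (-s * y) ∂(renewalMeasure p)) * Real.exp (s * x) := by
  have h := norm_integral_le_of_norm_le (f := fun y => z (x - y))
    ((integrable_exp_renewalMeasure hp).const_mul (L * Real.exp (s * x)))
    (ae_of_all _ fun y => abs_comp_sub_le hL hz hη hs x y)
  rw [integral_const_mul] at h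
  exact h.trans_eq (by ring)

lemma hasSubexpGrowth_renewalSolution [SFinite p] (hL : 0 ≤ L)
    (hz : ∀ x, |z x| ≤ L * Real.exp (-η * |x|)) (hη : 0 < η) (hs₀ : 0 < s₀)
    (hp : ∀ s, 0 < s → s ≤ s₀ → ∫⁻ x, ENNReal.ofReal (Real.exp (-s * x)) ∂p < 1) :
    HasSubexpGrowth (renewalSolution p z) := by
  refine ⟨min η s₀, lt_min hη hs₀, fun ε hε hε' => ?_⟩
  refine ⟨L * ∫ y, Real.exp (-ε * y) ∂(renewalMeasure p), ?_⟩
  rintro _ ⟨x, rfl⟩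
  have h := abs_renewalSolution_le hL hz (hε'.le.trans (min_le_left _ _)) hε.le
    (hp ε hε (hε'.le.trans (min_le_right _ _))) x
  have h1 : Real.exp (-ε * x) * Real.exp (ε * x) = 1 := by
    rw [← Real.exp_add, neg_mul, neg_add_cancel, Real.exp_zero]
  calc Real.exp (-ε * x) * |renewalSolution p z x|
      ≤ Real.exp (-ε * x) * (L * (∫ y, Real.exp (-ε * y) ∂(renewalMeasure p)) *
          Real.exp (ε * x)) := by gcongr
    _ = L * (∫ y, Real.exp (-ε * y) ∂(renewalMeasure p)) *
          (Real.exp (-ε * x) * Real.exp (ε * x)) := by ring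
    _ = _ := by rw [h1, mul_one]

/-- The renewal equation follows from `N = δ₀ + p * N`. -/
lemma isRenewalSolution_renewalSolution [SFinite p] (hzm : Measurable z) (hL : 0 ≤ L)
    (hz : ∀ x, |z x| ≤ L * Real.exp (-η * |x|)) (hη : s ≤ η) (hs : 0 ≤ s)
    (hp : ∫⁻ x, ENNReal.ofReal (Real.exp (-s * x)) ∂p < 1) :
    IsRenewalSolution p z (renewalSolution p z) := by
  intro x
  have hN : renewalMeasure p = Measure.dirac 0 + Measure.conv p (renewalMeasure p) := by
    conv_lhs => rw [renewalMeasure_eq_dirac_add p]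
    rw [Measure.conv_comm]
  have hi := integrable_comp_sub_renewalMeasure hzm hL hz hη hs hp x
  have hi2 := hi
  rw [hN] at hi2
  have hi3 := hi2.right_of_add_measure
  refine ⟨?_, ?_⟩
  · have h1 := ((integrable_exp_of_lintegral (hp.trans ENNReal.one_lt_top)).const_mul
      (L * (∫ y, Real.exp (-s * y) ∂(renewalMeasure p)) * Real.exp (s * x)))
    refine h1.mono' ((measurable_renewalSolution hzm).comp
      (measurable_const.sub measurable_id)).aestronglyMeasurable (ae_of_all _ fun y => ?_)
    refine (abs_renewalSolution_le hL hz hη hs hp (x - y)).trans_eq ?_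
    rw [mul_assoc _ (Real.exp (s * x)), ← Real.exp_add]
    congr 2; ring
  · conv_lhs => rw [renewalSolution, hN]
    rw [integral_add_measure hi2.left_of_add_measure hi3, integral_dirac, integral_conv hi3, sub_zero]
    simp only [renewalSolution, sub_sub]

/-- Solutions of the renewal equation are unique: weighted by `e^{-εx}`, the operator
`Z ↦ ∫ Z(· - y) p(dy)` contracts the supremum norm. -/
lemma IsRenewalSolution.eq_of_hasSubexpGrowth {Z Z' : ℝ → ℝ}
    (hZ : IsRenewalSolution p z Z) (hZg : HasSubexpGrowth Z)
    (hZ' : IsRenewalSolution p z Z') (hZg' : HasSubexpGrowth Z') (hs₀ : 0 < s₀)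
    (hp : ∀ s, 0 < s → s ≤ s₀ → ∫⁻ x, ENNReal.ofReal (Real.exp (-s * x)) ∂p < 1) : Z = Z' := by
  obtain ⟨ε₁, hε₁, h₁⟩ := hZg
  obtain ⟨ε₂, hε₂, h₂⟩ := hZg'
  obtain ⟨s, hs, hs'⟩ := exists_between (lt_min (lt_min hε₁ hε₂) hs₀)
  obtain ⟨B₁, hB₁⟩ := h₁ s hs (hs'.trans_le ((min_le_left _ _).trans (min_le_left _ _)))
  obtain ⟨B₂, hB₂⟩ := h₂ s hs (hs'.trans_le ((min_le_left _ _).trans (min_le_right _ _)))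
  have hps := hp s hs (hs'.le.trans (min_le_right _ _))
  have hi := integrable_exp_of_lintegral (hps.trans ENNReal.one_lt_top)
  set ρ := ∫ y, Real.exp (-s * y) ∂p with hρ
  have hρ0 : 0 ≤ ρ := integral_nonneg fun _ => Real.exp_nonneg _
  have hρ1 : ρ < 1 := by
    rw [← ofReal_integral_eq_lintegral_ofReal hi (ae_of_all _ fun _ => Real.exp_nonneg _)] at hps
    exact ENNReal.ofReal_lt_one.1 hps
  have hbase : ∀ x, |Z x - Z' x| ≤ (B₁ + B₂) * Real.exp (s * x) := fun x => by
    have a1 : Real.exp (-s * x) * |Z x| ≤ B₁ := hB₁ ⟨x, rfl⟩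
    have a2 : Real.exp (-s * x) * |Z' x| ≤ B₂ := hB₂ ⟨x, rfl⟩
    have a3 : Real.exp (-s * x) * |Z x - Z' x| ≤ B₁ + B₂ := by
      have := mul_le_mul_of_nonneg_left (abs_sub (Z x) (Z' x)) (Real.exp_nonneg (-s * x))
      linarith
    rwa [neg_mul, Real.exp_neg, inv_mul_le_iff₀ (Real.exp_pos _), mul_comm] at a3
  have hstep : ∀ n : ℕ, ∀ x, |Z x - Z' x| ≤ (B₁ + B₂) * ρ ^ n * Real.exp (s * x) := by
    intro n
    induction n with
    | zero => simpa using hbase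
    | succ n ih =>
      intro x
      have e1 : Z x - Z' x = ∫ y, (Z (x - y) - Z' (x - y)) ∂p := by
        rw [integral_sub (hZ x).1 (hZ' x).1, (hZ x).2, (hZ' x).2]
        ring
      have e2 := norm_integral_le_of_norm_le
        (hi.const_mul ((B₁ + B₂) * ρ ^ n * Real.exp (s * x)))
        (f := fun y => Z (x - y) - Z' (x - y)) (ae_of_all _ fun y => by
          refine (ih (x - y)).trans_eq ?_
          rw [mul_assoc _ (Real.exp (s * x)), ← Real.exp_add]
          congr 2; ring)
      rw [e1]
      refine e2.trans_eq ?_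
      rw [integral_const_mul, ← hρ]
      ring
  funext x
  have hlim : Tendsto (fun n : ℕ => (B₁ + B₂) * ρ ^ n * Real.exp (s * x)) atTop (𝓝 0) := by
    simpa using ((tendsto_pow_atTop_nhds_zero_of_lt_one hρ0 hρ1).const_mul (B₁ + B₂)).mul_const
      (Real.exp (s * x))
  have h0 := ge_of_tendsto' hlim fun n => hstep n x
  exact sub_eq_zero.1 (abs_nonpos_iff.1 h0)

end Renewal

/-! ### The atom of the finite part at the origin -/

namespace Renewal

open Filter Topology Complex ProbabilityTheory

section Tails

lemma setOf_le_abs_eq (x : ℝ) : {y : ℝ | x ≤ |y|} = Iic (-x) ∪ Ici x := by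
  ext y
  simp only [mem_ofPred_eq, mem_union, mem_Iic, mem_Ici, le_abs']

/-- Tails of order `e^{-rx}` give exponential moments of every order `s < r`. -/
lemma lintegral_exp_lt_top_of_tail {ν : Measure ℝ} [IsFiniteMeasure ν] {A : ℝ≥0∞} (hA : A ≠ ∞)
    {r s : ℝ} (hs : 0 ≤ s) (hsr : s < r)
    (ht : ∀ x : ℝ, 0 < x → ENNReal.ofReal (Real.exp (r * x)) * ν (Iic (-x) ∪ Ici x) ≤ A) :
    ∫⁻ y, ENNReal.ofReal (Real.exp (s * |y|)) ∂ν < ∞ := by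
  set A' := A + ν univ with hA'
  have hA'top : A' < ∞ := ENNReal.add_lt_top.2 ⟨hA.lt_top, measure_lt_top _ _⟩
  have hset : ∀ n : ℕ, MeasurableSet {y : ℝ | (n : ℝ) ≤ |y|} := fun n =>
    measurableSet_le measurable_const (by fun_prop)
  have htail : ∀ n : ℕ, ν {y : ℝ | (n : ℝ) ≤ |y|} ≤ ENNReal.ofReal (Real.exp (-r * n)) * A' := by
    intro n
    rcases Nat.eq_zero_or_pos n with rfl | hn
    · simpa using (measure_mono (subset_univ _)).trans (le_add_self : ν univ ≤ A')
    · have h1 := (ht n (by exact_mod_cast hn)).trans (le_self_add : A ≤ A')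
      rw [setOf_le_abs_eq]
      calc ν (Iic (-(n : ℝ)) ∪ Ici (n : ℝ))
          = ENNReal.ofReal (Real.exp (-r * n)) *
              (ENNReal.ofReal (Real.exp (r * n)) * ν (Iic (-(n : ℝ)) ∪ Ici (n : ℝ))) := by
            rw [← mul_assoc, ← ENNReal.ofReal_mul (Real.exp_nonneg _), ← Real.exp_add]
            simp
        _ ≤ _ := by gcongr
  have hpt : ∀ y : ℝ, ENNReal.ofReal (Real.exp (s * |y|)) ≤ ∑' n : ℕ,
      {y : ℝ | (n : ℝ) ≤ |y|}.indicator (fun _ => ENNReal.ofReal (Real.exp (s * (n + 1)))) y := by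
    intro y
    refine le_trans ?_ (ENNReal.le_tsum ⌊|y|⌋₊)
    have hy : y ∈ {w : ℝ | (⌊|y|⌋₊ : ℝ) ≤ |w|} := Nat.floor_le (abs_nonneg y)
    rw [indicator_of_mem hy]
    exact ENNReal.ofReal_le_ofReal (Real.exp_le_exp.2
      (mul_le_mul_of_nonneg_left (Nat.lt_floor_add_one _).le hs))
  have hgeom : ∀ n : ℕ, ENNReal.ofReal (Real.exp (s * (n + 1))) *
      (ENNReal.ofReal (Real.exp (-r * n)) * A') =
      ENNReal.ofReal (Real.exp s) * A' * ENNReal.ofReal (Real.exp (s - r)) ^ n := fun n => by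
    rw [← ENNReal.ofReal_pow (Real.exp_nonneg _), ← Real.exp_nat_mul, ← mul_assoc,
      ← ENNReal.ofReal_mul (Real.exp_nonneg _), ← Real.exp_add, mul_right_comm,
      ← ENNReal.ofReal_mul (Real.exp_nonneg _), ← Real.exp_add]
    congr 3; ring
  calc ∫⁻ y, ENNReal.ofReal (Real.exp (s * |y|)) ∂ν
      ≤ ∫⁻ y, ∑' n : ℕ, {y : ℝ | (n : ℝ) ≤ |y|}.indicator
          (fun _ => ENNReal.ofReal (Real.exp (s * (n + 1)))) y ∂ν := lintegral_mono hpt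
    _ = ∑' n : ℕ, ENNReal.ofReal (Real.exp (s * (n + 1))) * ν {y : ℝ | (n : ℝ) ≤ |y|} := by
        rw [lintegral_tsum fun n => (measurable_const.indicator (hset n)).aemeasurable]
        refine tsum_congr fun n => ?_
        rw [lintegral_indicator_const (hset n)]
    _ ≤ ∑' n : ℕ, ENNReal.ofReal (Real.exp s) * A' * ENNReal.ofReal (Real.exp (s - r)) ^ n := by
        refine ENNReal.tsum_le_tsum fun n => ?_
        rw [← hgeom]
        gcongr
        exact htail n
    _ < ∞ := by
        rw [ENNReal.tsum_mul_left, ENNReal.tsum_geometric]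
        refine ENNReal.mul_lt_top (ENNReal.mul_lt_top ENNReal.ofReal_lt_top hA'top) ?_
        rw [ENNReal.inv_lt_top]
        refine tsub_pos_of_lt (ENNReal.ofReal_lt_one.2 ?_)
        rw [Real.exp_lt_one_iff]
        linarith

end Tails

section SignedTransform

variable {g : ℝ → ℝ} {A r : ℝ}

lemma integral_exp_neg_abs {c : ℝ} (hc : 0 < c) : ∫ x : ℝ, Real.exp (-c * |x|) = 2 / c := by
  rw [integral_comp_abs (f := fun x => Real.exp (-c * x)), integral_exp_mul_Ioi (by linarith)]
  simp
  ring

lemma integrable_exp_neg_abs {c : ℝ} (hc : 0 < c) : Integrable fun x : ℝ => Real.exp (-c * |x|) := by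
  by_contra h
  have h1 := integral_exp_neg_abs hc
  rw [integral_undef h] at h1
  exact (div_pos two_pos hc).ne h1

lemma norm_cexp_mul_le (hg : ∀ x, |g x| ≤ A * Real.exp (-r * |x|)) {z : ℂ} {s : ℝ}
    (hz : |z.re| ≤ s) (x : ℝ) : ‖cexp (z * x) * g x‖ ≤ A * Real.exp (-(r - s) * |x|) := by
  have hA : 0 ≤ A := by simpa using (abs_nonneg _).trans (hg 0)
  have h1 : ‖cexp (z * x)‖ ≤ Real.exp (s * |x|) := by
    rw [Complex.norm_exp, Real.exp_le_exp]
    have : (z * x).re = z.re * x := by simp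
    rw [this]
    calc z.re * x ≤ |z.re * x| := le_abs_self _
      _ = |z.re| * |x| := abs_mul _ _
      _ ≤ s * |x| := by gcongr
  rw [norm_mul, Complex.norm_real, Real.norm_eq_abs]
  calc ‖cexp (z * x)‖ * |g x| ≤ Real.exp (s * |x|) * (A * Real.exp (-r * |x|)) := by
        gcongr
        exact hg x
    _ = A * Real.exp (-(r - s) * |x|) := by
        rw [mul_left_comm, ← Real.exp_add]
        congr 2; ring

lemma integrable_cexp_mul_of_decay (hgm : Measurable g)
    (hg : ∀ x, |g x| ≤ A * Real.exp (-r * |x|)) {z : ℂ} (hz : |z.re| < r) :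
    Integrable fun x : ℝ => cexp (z * x) * g x :=
  ((integrable_exp_neg_abs (sub_pos.2 hz)).const_mul A).mono' (by fun_prop)
    (ae_of_all _ fun x => norm_cexp_mul_le hg le_rfl x)

lemma norm_integral_cexp_mul_le (hr : 0 < r) (hg : ∀ x, |g x| ≤ A * Real.exp (-r * |x|)) {z : ℂ}
    (hz : |z.re| ≤ r / 2) : ‖∫ x : ℝ, cexp (z * x) * g x‖ ≤ 4 * A / r := by
  have h := norm_integral_le_of_norm_le
    ((integrable_exp_neg_abs (c := r - r / 2) (by linarith)).const_mul A)
    (ae_of_all _ fun x => norm_cexp_mul_le hg hz x)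
  rw [integral_const_mul, integral_exp_neg_abs (by linarith)] at h
  refine h.trans_eq ?_
  have : r ≠ 0 := hr.ne'
  rw [show r - r / 2 = r / 2 by ring]
  field_simp
  norm_num

/-- The transform of an exponentially decaying function is holomorphic in a strip; the function is
split into its positive and negative parts, which are densities of measures. -/
lemma differentiableOn_integral_cexp_mul (hgm : Measurable g)
    (hg : ∀ x, |g x| ≤ A * Real.exp (-r * |x|)) {s : ℝ} (hs : 0 ≤ s) (hsr : s < r) :
    DifferentiableOn ℂ (fun z : ℂ => ∫ x : ℝ, cexp (z * x) * g x) {z | |z.re| < s} := by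
  have key : ∀ k : ℝ → ℝ, Measurable k → (∀ x, 0 ≤ k x) → (∀ x, |k x| ≤ A * Real.exp (-r * |x|)) →
      DifferentiableOn ℂ (fun z : ℂ => ∫ x : ℝ, cexp (z * x) * k x) {z | |z.re| < s} := by
    intro k hkm hk0 hk
    have h1 : (fun z : ℂ => ∫ x : ℝ, cexp (z * x) * k x) =
        complexMGF id (volume.withDensity fun x => ENNReal.ofReal (k x)) := by
      funext z
      rw [complexMGF_withDensity hkm hk0]
    rw [h1]
    refine differentiableOn_complexMGF_strip ?_
    rw [integrable_withDensity_iff_integrable_smul' (by fun_prop) (by simp)]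
    refine ((integrable_exp_neg_abs (sub_pos.2 hsr)).const_mul A).mono' (by fun_prop)
      (ae_of_all _ fun x => ?_)
    have h2 := norm_cexp_mul_le (z := s) hk (s := s) (by simp [abs_of_nonneg hs]) |x|
    simp only [ENNReal.toReal_ofReal (hk0 x), smul_eq_mul, norm_mul, Real.norm_eq_abs, Real.abs_exp]
    have h3 := mul_le_mul_of_nonneg_right (hk x) (Real.exp_nonneg (s * |x|))
    rw [mul_assoc, ← Real.exp_add] at h3
    refine h3.trans_eq ?_
    congr 2; ring
  have hpos := key (fun x => max (g x) 0) (by fun_prop) (fun x => le_max_right _ _) fun x => by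
    refine le_trans ?_ (hg x)
    rw [abs_of_nonneg (le_max_right _ _)]
    exact max_le (le_abs_self _) (abs_nonneg _)
  have hneg := key (fun x => max (-g x) 0) (by fun_prop) (fun x => le_max_right _ _) fun x => by
    refine le_trans ?_ (hg x)
    rw [abs_of_nonneg (le_max_right _ _)]
    exact max_le (neg_le_abs _) (abs_nonneg _)
  refine (hpos.sub hneg).congr fun z hz => ?_
  have hz' : |z.re| < r := lt_trans hz hsr
  have hp' : Integrable fun x : ℝ => cexp (z * x) * (max (g x) 0 : ℝ) :=
    integrable_cexp_mul_of_decay (by fun_prop) (fun x => by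
      refine le_trans ?_ (hg x)
      rw [abs_of_nonneg (le_max_right _ _)]
      exact max_le (le_abs_self _) (abs_nonneg _)) hz'
  have hn' : Integrable fun x : ℝ => cexp (z * x) * (max (-g x) 0 : ℝ) :=
    integrable_cexp_mul_of_decay (by fun_prop) (fun x => by
      refine le_trans ?_ (hg x)
      rw [abs_of_nonneg (le_max_right _ _)]
      exact max_le (neg_le_abs _) (abs_nonneg _)) hz'
  simp only [Pi.sub_apply]
  rw [← integral_sub hp' hn']
  congr 1; funext x
  rw [← mul_sub, ← Complex.ofReal_sub]
  congr 2
  rcases le_total 0 (g x) with h | h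
  · rw [max_eq_left h, max_eq_right (by linarith), sub_zero]
  · rw [max_eq_right h, max_eq_left (by linarith)]; ring

end SignedTransform

section Bounds

variable {q : ℝ → ℝ} {A r ν : ℝ}

lemma le_at_zero_of_forall_pos {k : ℝ → ℝ} (hk : Continuous k) (h : ∀ x, 0 < x → k x ≤ A) :
    k 0 ≤ A := by
  have hcl : IsClosed {x | k x ≤ A} := isClosed_le hk continuous_const
  have h1 : closure (Ioi (0 : ℝ)) ⊆ {x | k x ≤ A} := hcl.closure_subset_iff.2 fun x hx => h x hx
  exact h1 (by rw [closure_Ioi]; exact self_mem_Ici)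

/-- The limit `ν` is controlled by the decay bounds: at `0` the density is within `A` both of `ν`
and of `0`. -/
lemma limit_le_two_mul (hq : Continuous q)
    (h1 : ∀ x, 0 < x → Real.exp (r * x) * |q x - ν| ≤ A)
    (h2 : ∀ x, 0 < x → Real.exp (r * x) * q (-x) ≤ A) : ν ≤ 2 * A := by
  have a1 := le_at_zero_of_forall_pos (A := A)
    (k := fun x => Real.exp (r * x) * |q x - ν|) (by fun_prop) h1
  have a2 := le_at_zero_of_forall_pos (A := A)
    (k := fun x => Real.exp (r * x) * q (-x)) (by fun_prop) h2
  simp only [mul_zero, Real.exp_zero, one_mul, neg_zero] at a1 a2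
  have := neg_abs_le (q 0 - ν)
  linarith

lemma abs_sub_indicator_le (hq : Continuous q) (h0 : ∀ x, 0 ≤ q x)
    (h1 : ∀ x, 0 < x → Real.exp (r * x) * |q x - ν| ≤ A)
    (h2 : ∀ x, 0 < x → Real.exp (r * x) * q (-x) ≤ A) (x : ℝ) :
    |q x - (Ioi (0 : ℝ)).indicator (fun _ => ν) x| ≤ A * Real.exp (-r * |x|) := by
  rw [neg_mul, Real.exp_neg, ← div_eq_mul_inv, le_div_iff₀ (Real.exp_pos _), mul_comm]
  rcases lt_trichotomy x 0 with hx | rfl | hx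
  · rw [indicator_of_notMem (by simpa using hx.le), sub_zero, abs_of_nonneg (h0 x), abs_of_neg hx]
    simpa using h2 (-x) (by linarith)
  · have a2 := le_at_zero_of_forall_pos (A := A)
      (k := fun x => Real.exp (r * x) * q (-x)) (by fun_prop) h2
    simpa [abs_of_nonneg (h0 0)] using a2
  · rw [indicator_of_mem (by simpa using hx), abs_of_pos hx]
    exact h1 x hx

end Bounds

section Atom

namespace Admissible

variable {τ M m γ T B : ℝ} {p a b : Measure ℝ} {f : ℝ → ℝ}

lemma le_renewalMeasure (b : Measure ℝ) [SFinite b] : b ≤ renewalMeasure b := by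
  have h : convPow b 1 = b := by simp [convPow]
  conv_lhs => rw [← h]
  exact Measure.le_sum (convPow b) 1

/-- Exponential moments of the finite part carry over to `p`, the other component of `p` having
compact support. -/
lemma integrable_exp_of_renewalMeasure (h : Admissible τ M m γ T B p a b f) {s : ℝ}
    (hs : Integrable (fun x => Real.exp (s * |x|)) (renewalMeasure b)) :
    Integrable (fun x => Real.exp (s * |x|)) p := by
  have := h.isFiniteMeasure_right
  rw [h.add]
  refine Integrable.add_measure ?_ (hs.mono_measure (le_renewalMeasure b))
  have hfm : Measurable f := h.contDiff.continuous.measurable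
  rw [h.density, integrable_withDensity_iff_integrable_smul' (by fun_prop) (by simp)]
  have hc : Continuous f := h.contDiff.continuous
  refine ((by fun_prop : Continuous fun x => f x * Real.exp (s * |x|)).integrable_of_hasCompactSupport
    h.hasCompactSupport.mul_right).congr (ae_of_all _ fun x => ?_)
  simp only [ENNReal.toReal_ofReal (h.nonneg x), smul_eq_mul]

/-- The renewal identity `(1 - p̂) N̂ = 1`, cleared of its pole at `0` and continued analytically
across the imaginary axis. Here `ν` is any constant for which `q - ν 1_{x > 0}` decays. -/
lemma continued_renewal_identity (h : Admissible τ M m γ T B p a b f) {s₀ s A r ν : ℝ}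
    (hs₀ : 0 < s₀) (hp : ∀ t, 0 < t → t ≤ s₀ → ∫⁻ x, ENNReal.ofReal (Real.exp (-t * x)) ∂p < 1)
    (hs : 0 < s) (hsr : s < r)
    (hb : Integrable (fun x => Real.exp (s * |x|)) (renewalMeasure b))
    (hg : ∀ x, |renewalDensity p b f x - (Ioi (0 : ℝ)).indicator (fun _ => ν) x| ≤
      A * Real.exp (-r * |x|)) {z : ℂ} (hz : |z.re| < s) :
    (1 - complexMGF id p z) * (z * (complexMGF id (renewalMeasure b) z +
      ∫ x : ℝ, cexp (z * x) * (renewalDensity p b f x - (Ioi (0 : ℝ)).indicator (fun _ => ν) x : ℝ))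
        - ν) = z := by
  have := h.prob
  have := h.isFiniteMeasure_right
  set q := renewalDensity p b f with hq
  have hqc : Continuous q := h.continuous_renewalDensity (hp s₀ hs₀ le_rfl)
  set g : ℝ → ℝ := fun x => q x - (Ioi (0 : ℝ)).indicator (fun _ => ν) x with hgdef
  have hgm : Measurable g :=
    hqc.measurable.sub (measurable_const.indicator measurableSet_Ioi)
  have hpi := h.integrable_exp_of_renewalMeasure hb
  set U : Set ℂ := {z | |z.re| < s} with hU
  have hUo : IsOpen U := isOpen_lt (by fun_prop) continuous_const
  have hUc : IsPreconnected U := by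
    have h1 : U = Complex.reLm ⁻¹' Ioo (-s) s := by
      ext w; simp [hU, abs_lt]
    rw [h1]
    exact ((convex_Ioo (-s) s).linear_preimage _).isPreconnected
  set H : ℂ → ℂ := fun z => (1 - complexMGF id p z) * (z * (complexMGF id (renewalMeasure b) z +
    ∫ x : ℝ, cexp (z * x) * g x) - ν) - z with hH
  have hHd : DifferentiableOn ℂ H U := by
    have d1 := differentiableOn_complexMGF_strip hpi
    have d2 := differentiableOn_complexMGF_strip hb
    have d3 := differentiableOn_integral_cexp_mul hgm hg hs.le hsr
    exact (((differentiableOn_const _).sub d1).mul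
      ((differentiableOn_id.mul (d2.add d3)).sub (differentiableOn_const _))).sub differentiableOn_id
  -- to the left of the imaginary axis the transform of the renewal measure itself converges
  have hleft : ∀ w : ℂ, -(min s₀ s) < w.re → w.re < 0 → H w = 0 := by
    intro w hw1 hw0
    have hws : |w.re| < s := by
      rw [abs_of_neg hw0]; linarith [min_le_right s₀ s]
    have hpw : ∫⁻ x, ENNReal.ofReal (Real.exp (w.re * x)) ∂p < 1 := by
      have := hp (-w.re) (by linarith) (by linarith [min_le_left s₀ s])
      simpa using this
    have hw : w ≠ 0 := by rintro rfl; simp at hw0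
    have hNi := integrable_cexp_mul (lintegral_exp_renewalMeasure_lt_top p hpw)
    have hNt := complexMGF_renewalMeasure p hpw
    have hne : 1 - complexMGF id p w ≠ 0 := by
      intro h0
      have h1 : ‖complexMGF id p w‖ₑ < 1 := (norm_complexMGF_le_toReal w).trans_lt hpw
      rw [← sub_eq_zero.1 h0] at h1
      simp at h1
    rw [h.renewalMeasure_eq (hp s₀ hs₀ le_rfl)] at hNi hNt
    have hsplit : complexMGF id (volume.withDensity (fun x => ENNReal.ofReal (q x)) +
        renewalMeasure b) w = (∫ x : ℝ, cexp (w * x) * q x) +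
          complexMGF id (renewalMeasure b) w := by
      rw [← complexMGF_withDensity hqc.measurable h.renewalDensity_nonneg]
      exact integral_add_measure hNi.left_of_add_measure hNi.right_of_add_measure
    have hgi := integrable_cexp_mul_of_decay hgm hg (hws.trans hsr)
    have hind : (fun x : ℝ => cexp (w * x) * ((Ioi (0 : ℝ)).indicator (fun _ => ν) x : ℝ)) =
        (Ioi (0 : ℝ)).indicator fun x : ℝ => cexp (w * x) * ν := by
      funext x
      by_cases hx : x ∈ Ioi (0 : ℝ)
      · rw [indicator_of_mem hx, indicator_of_mem hx]
      · rw [indicator_of_notMem hx, indicator_of_notMem hx]; simp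
    have hii : Integrable fun x : ℝ =>
        cexp (w * x) * ((Ioi (0 : ℝ)).indicator (fun _ => ν) x : ℝ) := by
      rw [hind, integrable_indicator_iff measurableSet_Ioi]
      exact (integrableOn_exp_mul_complex_Ioi hw0 0).mul_const _
    have hqt : ∫ x : ℝ, cexp (w * x) * q x = (∫ x : ℝ, cexp (w * x) * g x) - ν / w := by
      have e1 : ∀ x : ℝ, cexp (w * x) * q x = cexp (w * x) * g x +
          cexp (w * x) * ((Ioi (0 : ℝ)).indicator (fun _ => ν) x : ℝ) := fun x => by
        rw [← mul_add, ← Complex.ofReal_add]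
        simp [hgdef]
      simp only [e1]
      rw [integral_add hgi hii, hind, integral_indicator measurableSet_Ioi, integral_mul_const,
        integral_exp_mul_complex_Ioi hw0]
      simp only [ofReal_zero, mul_zero, Complex.exp_zero]
      ring
    rw [hsplit, hqt, eq_comm, inv_eq_iff_eq_inv] at hNt
    have h1 : (1 - complexMGF id p w) * ((∫ x : ℝ, cexp (w * x) * g x) - ν / w +
        complexMGF id (renewalMeasure b) w) = 1 := by
      rw [hNt] at hne ⊢
      exact inv_mul_cancel₀ (by simpa using hne)
    have h2 : H w = w * ((1 - complexMGF id p w) * ((∫ x : ℝ, cexp (w * x) * g x) - ν / w +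
        complexMGF id (renewalMeasure b) w) - 1) := by
      simp only [hH]
      field_simp
      ring
    rw [h2, h1, sub_self, mul_zero]
  have hmin : 0 < min s₀ s := lt_min hs₀ hs
  have hz₀ : ((-(min s₀ s / 2) : ℝ) : ℂ) ∈ U := by
    simp only [hU, mem_ofPred_eq, Complex.ofReal_re, abs_neg, abs_of_pos (half_pos hmin)]
    linarith [min_le_right s₀ s]
  have hev : H =ᶠ[𝓝 ((-(min s₀ s / 2) : ℝ) : ℂ)] 0 := by
    have hopen : IsOpen {w : ℂ | -(min s₀ s) < w.re ∧ w.re < 0} :=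
      (isOpen_lt continuous_const continuous_re).inter (isOpen_lt continuous_re continuous_const)
    filter_upwards [hopen.mem_nhds (show ((-(min s₀ s / 2) : ℝ) : ℂ) ∈
      {w : ℂ | -(min s₀ s) < w.re ∧ w.re < 0} by
        simp only [mem_ofPred_eq, Complex.ofReal_re]; constructor <;> linarith)] with w hw
    exact hleft w hw.1 hw.2
  have hz0 : H z = 0 :=
    (hHd.analyticOnNhd hUo).eqOn_zero_of_preconnected_of_eventuallyEq_zero hUc hz₀ hev hz
  exact sub_eq_zero.1 hz0

/-- The atom of the finite part at the origin is controlled by the decay of the density alone. The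
tails of the finite part do not see this atom; but if it were large, the continued transform of the
renewal measure would have to vanish at a point `s > 0`, where it equals `1 / (1 - p̂(s)) < 0`. -/
lemma renewalMeasure_singleton_le (h : Admissible τ M m γ T B p a b f) (hτ : 0 < τ) (hm : 0 < m)
    {s₀ A r : ℝ}
    (hγ : γ < 1) (hs₀ : 0 < s₀)
    (hp : ∀ t, 0 < t → t ≤ s₀ → ∫⁻ x, ENNReal.ofReal (Real.exp (-t * x)) ∂p < 1) (hr : 0 < r)
    (h1 : ∀ x, 0 < x → Real.exp (r * x) * |renewalDensity p b f x - (mean p)⁻¹| ≤ A)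
    (h2 : ∀ x, 0 < x → Real.exp (r * x) * renewalDensity p b f (-x) ≤ A) {A₂ : ℝ≥0∞} (hA₂ : A₂ ≠ ∞)
    (h3 : ∀ x, 0 < x →
      ENNReal.ofReal (Real.exp (r * x)) * renewalMeasure b (Iic (-x) ∪ Ici x) ≤ A₂) :
    renewalMeasure b {0} ≤ ENNReal.ofReal (8 * A / r) := by
  have := h.prob
  have hfin : IsFiniteMeasure (renewalMeasure b) := ⟨h.renewalMeasure_right_univ_le.trans_lt (by
    rw [ENNReal.inv_lt_top]
    exact tsub_pos_of_lt (ENNReal.ofReal_lt_one.2 hγ))⟩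
  have hqc := h.continuous_renewalDensity (hp s₀ hs₀ le_rfl)
  have hg := abs_sub_indicator_le hqc h.renewalDensity_nonneg h1 h2
  have hν := limit_le_two_mul hqc h1 h2
  have hmean : 0 < mean p := hm.trans_le h.le_mean
  set ν := (mean p)⁻¹ with hνdef
  have hbi : Integrable (fun x => Real.exp (3 * r / 4 * |x|)) (renewalMeasure b) := by
    refine ⟨by fun_prop, ?_⟩
    rw [hasFiniteIntegral_iff_ofReal (ae_of_all _ fun x => Real.exp_nonneg _)]
    exact lintegral_exp_lt_top_of_tail hA₂ (by positivity) (by linarith) h3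
  have hpi := h.integrable_exp_of_renewalMeasure hbi
  have hr2 : |((r / 2 : ℝ) : ℂ).re| < 3 * r / 4 := by
    rw [Complex.ofReal_re, abs_of_pos (by positivity)]; linarith
  have hid := h.continued_renewal_identity hs₀ hp (by positivity) (by linarith) hbi hg hr2
  have hD := norm_integral_cexp_mul_le hr hg (z := ((r / 2 : ℝ) : ℂ))
    (by rw [Complex.ofReal_re, abs_of_pos (by positivity)])
  set g : ℝ → ℝ := fun x => renewalDensity p b f x - (Ioi (0 : ℝ)).indicator (fun _ => ν) x
    with hgdef
  have hDr : (∫ x : ℝ, cexp (((r / 2 : ℝ) : ℂ) * x) * (g x : ℝ)) =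
      ((∫ x : ℝ, Real.exp (r / 2 * x) * g x : ℝ) : ℂ) := by
    rw [← integral_complex_ofReal]
    simp
  rw [hDr, complexMGF_ofReal, complexMGF_ofReal] at hid
  rw [hDr, Complex.norm_real, Real.norm_eq_abs] at hD
  set D := ∫ x : ℝ, Real.exp (r / 2 * x) * g x with hDdef
  have hidr : (1 - mgf id p (r / 2)) * (r / 2 * (mgf id (renewalMeasure b) (r / 2) + D) - ν) =
      r / 2 := by exact_mod_cast hid
  have hei : Integrable (fun x => Real.exp (r / 2 * x)) p :=
    integrable_exp_of_abs_le hpi (by rw [abs_of_pos (by positivity)]; linarith)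
  have hmgf : 1 < mgf id p (r / 2) := by
    have hx := integrable_id_of_exp hτ h.integrable_exp
    have e1 : ∫ x, (r / 2 * x + 1) ∂p ≤ ∫ x, Real.exp (r / 2 * x) ∂p :=
      integral_mono ((hx.const_mul _).add (integrable_const _)) hei
        fun x => Real.add_one_le_exp _
    rw [integral_add (hx.const_mul _) (integrable_const _), integral_const_mul] at e1
    simp only [integral_const, probReal_univ, smul_eq_mul, mul_one] at e1
    have e2 : mgf id p (r / 2) = ∫ x, Real.exp (r / 2 * x) ∂p := rfl
    have e3 : 0 < r / 2 * ∫ x, x ∂p := mul_pos (by positivity) hmean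
    linarith
  have hneg : r / 2 * (mgf id (renewalMeasure b) (r / 2) + D) - ν < 0 := by
    by_contra hcon
    have := mul_nonpos_of_nonpos_of_nonneg (by linarith : 1 - mgf id p (r / 2) ≤ 0)
      (not_lt.1 hcon)
    linarith
  have hatom : (renewalMeasure b).real {0} ≤ mgf id (renewalMeasure b) (r / 2) := by
    have hebi : Integrable (fun x => Real.exp (r / 2 * x)) (renewalMeasure b) :=
      integrable_exp_of_abs_le hbi (by rw [abs_of_pos (by positivity)]; linarith)
    have e1 := setIntegral_le_integral (s := {0}) hebi (ae_of_all _ fun x => Real.exp_nonneg _)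
    rw [integral_singleton] at e1
    simpa [mgf] using e1
  have hfinal : (renewalMeasure b).real {0} ≤ 8 * A / r := by
    have e1 := neg_abs_le D
    rw [le_div_iff₀ hr]
    rw [le_div_iff₀ hr] at hD
    nlinarith
  exact (ENNReal.le_ofReal_iff_toReal_le (measure_ne_top _ _) (by
    have : 0 ≤ (renewalMeasure b).real {0} := measureReal_nonneg
    linarith)).2 hfinal

end Admissible

end Atom

end Renewal

/-! ### Exponential estimates for the solution -/

namespace Renewal

open Filter Topology ProbabilityTheory

section FinitePart

variable {κ : Measure ℝ} {A₂ : ℝ≥0∞} {r : ℝ}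

/-- The tail bounds control the mass away from the origin. -/
lemma measure_univ_le_of_tail (hr : 0 < r)
    (h : ∀ x : ℝ, 0 < x → ENNReal.ofReal (Real.exp (r * x)) * κ (Iic (-x) ∪ Ici x) ≤ A₂) :
    κ univ ≤ κ {0} + A₂ := by
  have hU : (univ : Set ℝ) = {0} ∪ ⋃ n : ℕ, {y : ℝ | 1 / ((n : ℝ) + 1) ≤ |y|} := by
    refine (eq_univ_of_forall fun y => ?_).symm
    by_cases hy : y = 0
    · exact Or.inl hy
    · obtain ⟨n, hn⟩ := exists_nat_one_div_lt (abs_pos.2 hy)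
      exact Or.inr (mem_iUnion.2 ⟨n, hn.le⟩)
  have hmono : Monotone fun n : ℕ => {y : ℝ | 1 / ((n : ℝ) + 1) ≤ |y|} := fun k n hkn y hy =>
    show 1 / ((n : ℝ) + 1) ≤ |y| from
      (Nat.one_div_le_one_div hkn).trans (show 1 / ((k : ℝ) + 1) ≤ |y| from hy)
  rw [hU]
  refine (measure_union_le _ _).trans (add_le_add le_rfl ?_)
  rw [hmono.measure_iUnion]
  refine iSup_le fun n => ?_
  rw [setOf_le_abs_eq]
  have hn : (0 : ℝ) < 1 / ((n : ℝ) + 1) := by positivity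
  refine le_trans ?_ (h _ hn)
  refine le_mul_of_one_le_left zero_le ?_
  rw [ENNReal.one_le_ofReal]
  exact Real.one_le_exp (by positivity)

/-- Splitting at `|y| = |x| / 2`: either `z` is evaluated far from the origin, or `y` lies in the
tail of `κ`. Each alternative loses half of the exponential rate. -/
lemma mul_lintegral_comp_sub_le {z : ℝ → ℝ} {L η α : ℝ} (hL : 0 ≤ L)
    (hz : ∀ x, |z x| ≤ L * Real.exp (-η * |x|)) (hη : 0 ≤ η) (hα : α ≤ η / 2) (hα' : α ≤ r / 2)
    (h : ∀ x : ℝ, 0 < x → ENNReal.ofReal (Real.exp (r * x)) * κ (Iic (-x) ∪ Ici x) ≤ A₂)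
    {x : ℝ} (hx : x ≠ 0) :
    ENNReal.ofReal (Real.exp (α * |x|)) * ∫⁻ y, ENNReal.ofReal |z (x - y)| ∂κ ≤
      ENNReal.ofReal L * (κ univ + A₂) := by
  have hx0 : 0 < |x| := abs_pos.2 hx
  set S : Set ℝ := {y | |x| / 2 ≤ |y|} with hS
  have hSm : MeasurableSet S := measurableSet_le measurable_const (by fun_prop)
  have hpt : ∀ y, ENNReal.ofReal |z (x - y)| ≤ ENNReal.ofReal (L * Real.exp (-η * (|x| / 2))) +
      S.indicator (fun _ => ENNReal.ofReal L) y := fun y => by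
    by_cases hy : y ∈ S
    · rw [indicator_of_mem hy]
      refine le_trans (ENNReal.ofReal_le_ofReal ((hz _).trans ?_)) le_add_self
      refine mul_le_of_le_one_right hL (Real.exp_le_one_iff.2 ?_)
      rw [neg_mul]
      exact neg_nonpos.2 (by positivity)
    · rw [indicator_of_notMem hy, add_zero]
      refine ENNReal.ofReal_le_ofReal ((hz _).trans ?_)
      refine mul_le_mul_of_nonneg_left (Real.exp_le_exp.2 ?_) hL
      have h1 : |y| < |x| / 2 := not_le.1 hy
      have h2 := abs_sub_abs_le_abs_sub x y
      rw [neg_mul, neg_mul]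
      exact neg_le_neg (mul_le_mul_of_nonneg_left (by linarith) hη)
  have htail := h (|x| / 2) (by positivity)
  rw [← setOf_le_abs_eq] at htail
  calc ENNReal.ofReal (Real.exp (α * |x|)) * ∫⁻ y, ENNReal.ofReal |z (x - y)| ∂κ
      ≤ ENNReal.ofReal (Real.exp (α * |x|)) *
          (ENNReal.ofReal (L * Real.exp (-η * (|x| / 2))) * κ univ + ENNReal.ofReal L * κ S) := by
        gcongr
        refine (lintegral_mono hpt).trans_eq ?_
        rw [lintegral_add_left measurable_const, lintegral_const, lintegral_indicator_const hSm]
    _ = ENNReal.ofReal (Real.exp (α * |x|) * (L * Real.exp (-η * (|x| / 2)))) * κ univ +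
          ENNReal.ofReal L * (ENNReal.ofReal (Real.exp (α * |x|)) * κ S) := by
        rw [ENNReal.ofReal_mul (Real.exp_nonneg _)]
        ring
    _ ≤ ENNReal.ofReal L * κ univ + ENNReal.ofReal L * A₂ := by
        refine add_le_add (mul_le_mul_left (ENNReal.ofReal_le_ofReal ?_) _) ?_
        · rw [mul_left_comm, ← Real.exp_add]
          refine mul_le_of_le_one_right hL (Real.exp_le_one_iff.2 ?_)
          nlinarith
        · refine mul_le_mul_right (le_trans ?_ htail) _
          refine mul_le_mul_left (ENNReal.ofReal_le_ofReal (Real.exp_le_exp.2 ?_)) _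
          nlinarith
    _ = _ := by rw [mul_add]

end FinitePart

section ContinuousPart

variable {z k : ℝ → ℝ} {L η A β : ℝ}

/-- Convolution with `k` preserves decay at the rate `β` up to half of the rate of `z`. -/
lemma mul_abs_integral_comp_sub_mul_le (hL : 0 ≤ L)
    (hz : ∀ x, |z x| ≤ L * Real.exp (-η * |x|)) (hη : 0 < η) (hβ : |β| ≤ η / 2)
    (hk : ∀ y, Real.exp (β * y) * |k y| ≤ A) (x : ℝ) :
    Real.exp (β * x) * |∫ y, z (x - y) * k y| ≤ 4 * (L * A) / η := by
  have hA : 0 ≤ A := le_trans (by positivity) (hk 0)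
  have hint : Integrable fun y => L * A * Real.exp (-(η / 2) * |x - y|) :=
    ((integrable_exp_neg_abs (half_pos hη)).comp_sub_left x).const_mul _
  have hpt : ∀ y, ‖Real.exp (β * x) * (z (x - y) * k y)‖ ≤
      L * A * Real.exp (-(η / 2) * |x - y|) := fun y => by
    rw [norm_mul, norm_mul, Real.norm_of_nonneg (Real.exp_nonneg _), Real.norm_eq_abs,
      Real.norm_eq_abs]
    calc Real.exp (β * x) * (|z (x - y)| * |k y|)
        = Real.exp (β * (x - y)) * |z (x - y)| * (Real.exp (β * y) * |k y|) := by
          rw [show β * x = β * (x - y) + β * y by ring, Real.exp_add]; ring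
      _ ≤ Real.exp (β * (x - y)) * (L * Real.exp (-η * |x - y|)) * A := by
          gcongr
          · exact hz _
          · exact hk y
      _ = L * A * (Real.exp (β * (x - y)) * Real.exp (-η * |x - y|)) := by ring
      _ ≤ L * A * Real.exp (-(η / 2) * |x - y|) := by
          rw [← Real.exp_add]
          refine mul_le_mul_of_nonneg_left (Real.exp_le_exp.2 ?_) (mul_nonneg hL hA)
          have h1 : β * (x - y) ≤ |β| * |x - y| := (le_abs_self _).trans_eq (abs_mul _ _)
          have h2 : |β| * |x - y| ≤ η / 2 * |x - y| := by gcongr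
          linarith
  have h := norm_integral_le_of_norm_le hint (ae_of_all _ hpt)
  rw [integral_const_mul, integral_const_mul, norm_mul, Real.norm_of_nonneg (Real.exp_nonneg _),
    Real.norm_eq_abs,
    integral_sub_left_eq_self (fun u => Real.exp (-(η / 2) * |u|)) volume x,
    integral_exp_neg_abs (half_pos hη)] at h
  refine h.trans_eq ?_
  field_simp
  norm_num

lemma integrable_of_decay (hzm : Measurable z) (hz : ∀ x, |z x| ≤ L * Real.exp (-η * |x|))
    (hη : 0 < η) : Integrable z :=
  ((integrable_exp_neg_abs hη).const_mul L).mono' hzm.aestronglyMeasurable (ae_of_all _ hz)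

end ContinuousPart

section Weights

variable {q : ℝ → ℝ} {A r ν α : ℝ}

lemma exp_mul_abs_sub_le (hq : Continuous q) (h0 : ∀ x, 0 ≤ q x) (hr : 0 < r) (hν : 0 ≤ ν)
    (hα : 0 ≤ α) (hαr : α ≤ r)
    (h1 : ∀ x, 0 < x → Real.exp (r * x) * |q x - ν| ≤ A)
    (h2 : ∀ x, 0 < x → Real.exp (r * x) * q (-x) ≤ A) (y : ℝ) :
    Real.exp (α * y) * |q y - ν| ≤ 3 * A ∧ Real.exp (-α * y) * |q y| ≤ 3 * A := by
  have hg := abs_sub_indicator_le hq h0 h1 h2 y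
  have hν2 := limit_le_two_mul hq h1 h2
  have hA : 0 ≤ A := by linarith
  have hle : A * Real.exp (-r * |y|) ≤ A :=
    mul_le_of_le_one_right hA (Real.exp_le_one_iff.2 (by nlinarith [abs_nonneg y]))
  have hw : Real.exp (α * |y|) * (A * Real.exp (-r * |y|)) ≤ A := by
    rw [mul_left_comm, ← Real.exp_add]
    exact mul_le_of_le_one_right hA (Real.exp_le_one_iff.2 (by nlinarith [abs_nonneg y]))
  rcases lt_or_ge 0 y with hy | hy
  · rw [indicator_of_mem (show y ∈ Ioi (0 : ℝ) from hy)] at hg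
    have hyabs : |y| = y := abs_of_pos hy
    refine ⟨?_, ?_⟩
    · have := mul_le_mul_of_nonneg_left hg (Real.exp_nonneg (α * |y|))
      rw [hyabs] at this hw
      linarith
    · have h3 : |q y| ≤ 3 * A := by
        have h4 := abs_sub_abs_le_abs_sub (q y) ν
        rw [abs_of_nonneg hν] at h4
        linarith
      have h5 : Real.exp (-α * y) ≤ 1 := Real.exp_le_one_iff.2 (by nlinarith)
      nlinarith [abs_nonneg (q y), Real.exp_nonneg (-α * y)]
  · rw [indicator_of_notMem (show y ∉ Ioi (0 : ℝ) from not_lt.2 hy), sub_zero] at hg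
    have hyabs : |y| = -y := abs_of_nonpos hy
    refine ⟨?_, ?_⟩
    · have h3 : |q y - ν| ≤ 3 * A := by
        have h4 := abs_sub (q y) ν
        rw [abs_of_nonneg hν] at h4
        linarith
      have h5 : Real.exp (α * y) ≤ 1 := Real.exp_le_one_iff.2 (by nlinarith)
      nlinarith [abs_nonneg (q y - ν), Real.exp_nonneg (α * y)]
    · have := mul_le_mul_of_nonneg_left hg (Real.exp_nonneg (α * |y|))
      rw [show -α * y = α * |y| by rw [hyabs]; ring]
      linarith

end Weights

namespace Admissible

variable {τ M m γ T B : ℝ} {p a b : Measure ℝ} {f : ℝ → ℝ}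

/-- The two-sided estimate for a single member: the solution approaches `(mean p)⁻¹ * ∫ z` on the
right and `0` on the left. -/
lemma abs_renewalSolution_sub_le (h : Admissible τ M m γ T B p a b f) (hτ : 0 < τ) (hm : 0 < m)
    (hγ : γ < 1) {s₀ A A₂ L η r : ℝ} (hs₀ : 0 < s₀)
    (hp : ∀ t, 0 < t → t ≤ s₀ → ∫⁻ x, ENNReal.ofReal (Real.exp (-t * x)) ∂p < 1) (hr : 0 < r)
    (h1 : ∀ x, 0 < x → Real.exp (r * x) * |renewalDensity p b f x - (mean p)⁻¹| ≤ A)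
    (h2 : ∀ x, 0 < x → Real.exp (r * x) * renewalDensity p b f (-x) ≤ A) (hA₂ : 0 ≤ A₂)
    (h3 : ∀ x, 0 < x → ENNReal.ofReal (Real.exp (r * x)) *
      renewalMeasure b (Iic (-x) ∪ Ici x) ≤ ENNReal.ofReal A₂)
    {z : ℝ → ℝ} (hzm : Measurable z) (hL : 0 ≤ L) (hη : 0 < η)
    (hz : ∀ x, |z x| ≤ L * Real.exp (-η * |x|)) :
    let K := 12 * (L * A) / η + L * (8 * A / r + 2 * A₂)
    (∀ x, 0 < x → Real.exp (min η r / 2 * x) *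
      |renewalSolution p z x - (mean p)⁻¹ * ∫ y, z y| ≤ K) ∧
    (∀ x, x < 0 → Real.exp (min η r / 2 * |x|) * |renewalSolution p z x| ≤ K) := by
  intro K
  have := h.prob
  set α := min η r / 2 with hα
  have hα0 : 0 ≤ α := by positivity
  have hαη : α ≤ η / 2 := by have := min_le_left η r; linarith
  have hαr : α ≤ r / 2 := by have := min_le_right η r; linarith
  set q := renewalDensity p b f with hq
  set ν := (mean p)⁻¹ with hν
  have hν0 : 0 ≤ ν := inv_nonneg.2 (hm.le.trans h.le_mean)
  have hqc : Continuous q := h.continuous_renewalDensity (hp s₀ hs₀ le_rfl)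
  have hq0 : ∀ y, 0 ≤ q y := h.renewalDensity_nonneg
  have hA : 0 ≤ A := by have := limit_le_two_mul hqc h1 h2; linarith
  have hwt := exp_mul_abs_sub_le hqc hq0 hr hν0 hα0 (by linarith) h1 h2
  have hatom := h.renewalMeasure_singleton_le hτ hm hγ hs₀ hp hr h1 h2 ENNReal.ofReal_ne_top h3
  have hmass : renewalMeasure b univ ≤ ENNReal.ofReal (8 * A / r) + ENNReal.ofReal A₂ :=
    (measure_univ_le_of_tail hr h3).trans (add_le_add hatom le_rfl)
  -- the solution is the sum of its two components
  set s := min η s₀ with hs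
  have hs0 : 0 < s := lt_min hη hs₀
  have hNi : ∀ x, Integrable (fun y => z (x - y)) (renewalMeasure p) :=
    integrable_comp_sub_renewalMeasure hzm hL hz (min_le_left _ _) hs0.le
      (hp s hs0 (min_le_right _ _))
  have hN := h.renewalMeasure_eq (hp s₀ hs₀ le_rfl)
  have hqi : ∀ x, Integrable (fun y => z (x - y))
      (volume.withDensity fun x => ENNReal.ofReal (q x)) := fun x => by
    have := hNi x
    rw [hN] at this
    exact this.left_of_add_measure
  have hbi : ∀ x, Integrable (fun y => z (x - y)) (renewalMeasure b) := fun x => by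
    have := hNi x
    rw [hN] at this
    exact this.right_of_add_measure
  have hqi' : ∀ x, Integrable fun y => z (x - y) * q y := fun x => by
    have := hqi x
    rw [integrable_withDensity_iff_integrable_smul' (by fun_prop) (by simp)] at this
    refine this.congr (ae_of_all _ fun y => ?_)
    simp only [ENNReal.toReal_ofReal (hq0 y), smul_eq_mul]
    exact mul_comm _ _
  have hsplit : ∀ x, renewalSolution p z x =
      (∫ y, z (x - y) * q y) + ∫ y, z (x - y) ∂(renewalMeasure b) := fun x => by
    rw [renewalSolution, hN, integral_add_measure (hqi x) (hbi x),
      integral_withDensity_eq_integral_toReal_smul (by fun_prop) (by simp)]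
    congr 1
    refine integral_congr_ae (ae_of_all _ fun y => ?_)
    simp only [ENNReal.toReal_ofReal (hq0 y), smul_eq_mul]
    exact mul_comm _ _
  have hfin : ∀ x, x ≠ 0 → Real.exp (α * |x|) * |∫ y, z (x - y) ∂(renewalMeasure b)| ≤
      L * (8 * A / r + 2 * A₂) := fun x hx => by
    have e1 := mul_lintegral_comp_sub_le hL hz hη.le hαη hαr h3 hx
    have e2 : ENNReal.ofReal (Real.exp (α * |x|) * |∫ y, z (x - y) ∂(renewalMeasure b)|) ≤
        ENNReal.ofReal (L * (8 * A / r + 2 * A₂)) := by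
      calc _ = ENNReal.ofReal (Real.exp (α * |x|)) * ‖∫ y, z (x - y) ∂(renewalMeasure b)‖ₑ := by
            rw [ENNReal.ofReal_mul (Real.exp_nonneg _), ← ofReal_norm, Real.norm_eq_abs]
        _ ≤ ENNReal.ofReal (Real.exp (α * |x|)) *
              ∫⁻ y, ENNReal.ofReal |z (x - y)| ∂(renewalMeasure b) := by
            gcongr
            refine (enorm_integral_le_lintegral_enorm _).trans_eq (lintegral_congr fun y => ?_)
            rw [← ofReal_norm, Real.norm_eq_abs]
        _ ≤ ENNReal.ofReal L * (renewalMeasure b univ + ENNReal.ofReal A₂) := e1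
        _ ≤ ENNReal.ofReal L * (ENNReal.ofReal (8 * A / r) + ENNReal.ofReal A₂ +
              ENNReal.ofReal A₂) := by gcongr
        _ = _ := by
            rw [← ENNReal.ofReal_add (by positivity) hA₂, ← ENNReal.ofReal_add (by positivity) hA₂,
              ← ENNReal.ofReal_mul hL]
            congr 2; ring
    exact (ENNReal.ofReal_le_ofReal_iff (by positivity)).1 e2
  have hconst : 4 * (L * (3 * A)) / η = 12 * (L * A) / η := by ring
  refine ⟨fun x hx => ?_, fun x hx => ?_⟩
  · have hzi : Integrable fun y => z (x - y) := (integrable_of_decay hzm hz hη).comp_sub_left x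
    have e1 : renewalSolution p z x - ν * ∫ y, z y =
        (∫ y, z (x - y) * (q y - ν)) + ∫ y, z (x - y) ∂(renewalMeasure b) := by
      rw [hsplit]
      simp only [mul_sub]
      rw [integral_sub (hqi' x) (hzi.mul_const ν), integral_mul_const,
        integral_sub_left_eq_self z volume x]
      ring
    have e2 := mul_abs_integral_comp_sub_mul_le hL hz hη (β := α)
      (by rwa [abs_of_nonneg hα0]) (fun y => (hwt y).1) x
    have e3 := hfin x hx.ne'
    rw [abs_of_pos hx] at e3
    rw [e1]
    calc _ ≤ Real.exp (α * x) * (|∫ y, z (x - y) * (q y - ν)| +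
          |∫ y, z (x - y) ∂(renewalMeasure b)|) := by
          gcongr
          exact abs_add_le _ _
      _ ≤ K := by rw [mul_add]; linarith
  · have e2 := mul_abs_integral_comp_sub_mul_le hL hz hη (β := -α)
      (by rwa [abs_neg, abs_of_nonneg hα0]) (fun y => (hwt y).2) x
    have e3 := hfin x hx.ne
    rw [show -α * x = α * |x| by rw [abs_of_neg hx]; ring] at e2
    rw [hsplit]
    calc _ ≤ Real.exp (α * |x|) * (|∫ y, z (x - y) * q y| +
          |∫ y, z (x - y) ∂(renewalMeasure b)|) := by
          gcongr
          exact abs_add_le _ _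
      _ ≤ K := by rw [mul_add]; linarith

end Admissible

end Renewal

open Renewal in
theorem corollary1p1 :
    -- the constant `C(A₁, A₂, L, η, r)`, chosen before the family and everything else
    ∃ C : ℝ × ℝ × ℝ × ℝ × ℝ → ℝ,
      ContinuousOn C {v | 0 ≤ v.1 ∧ 0 ≤ v.2.1 ∧ 0 ≤ v.2.2.1 ∧ 0 < v.2.2.2.1 ∧ 0 < v.2.2.2.2} ∧
      ∀ (ι : Type*) (p Φ Ψ : ι → Measure ℝ) (φ : ι → ℝ → ℝ) (lam : ι → ℝ),
        Renewal.IsUniformFamily p Φ Ψ φ lam →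
        -- the decomposition of the renewal measures
        (∀ i, Renewal.renewalMeasure (p i) =
          volume.withDensity
            (fun x => ENNReal.ofReal (Renewal.acDensity (p i) (Ψ i) (φ i) (lam i) x)) +
          Renewal.finitePart (Ψ i) (lam i)) ∧
        (⨆ i, Renewal.finitePart (Ψ i) (lam i) univ) < ∞ ∧
        -- `A₁` and `A₂` are finite for all sufficiently small `r > 0`
        (∃ r₀ : ℝ, 0 < r₀ ∧ ∀ r : ℝ, 0 < r → r < r₀ →
          Renewal.boundA₁ p Ψ φ lam r < ∞ ∧ Renewal.boundA₂ Ψ lam r < ∞) ∧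
        ∀ (z : ι → ℝ → ℝ) (η : ℝ), (∀ i, Measurable (z i)) → 0 < η → Renewal.boundL z η < ∞ →
          -- existence and uniqueness
          (∀ i, ∃! Z : ℝ → ℝ,
            Renewal.IsRenewalSolution (p i) (z i) Z ∧ Renewal.HasSubexpGrowth Z) ∧
          -- the uniform exponential bounds
          ∀ Z : ι → ℝ → ℝ,
            (∀ i, Renewal.IsRenewalSolution (p i) (z i) (Z i) ∧
              Renewal.HasSubexpGrowth (Z i)) →
            (∀ i, Measurable (Z i)) ∧
            ∀ r : ℝ, 0 < r →
              Renewal.boundA₁ p Ψ φ lam r < ∞ → Renewal.boundA₂ Ψ lam r < ∞ →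
              (⨆ (i : ι) (x : ℝ) (_ : 0 < x), ENNReal.ofReal
                  (Real.exp (min η r / 2 * x) *
                    |Z i x - (Renewal.mean (p i))⁻¹ * ∫ y, z i y|)) +
                (⨆ (i : ι) (x : ℝ) (_ : x < 0), ENNReal.ofReal
                  (Real.exp (min η r / 2 * |x|) * |Z i x|)) ≤
              ENNReal.ofReal (C ((Renewal.boundA₁ p Ψ φ lam r).toReal,
                (Renewal.boundA₂ Ψ lam r).toReal, (Renewal.boundL z η).toReal, η, r)) := by
  refine ⟨fun v => 2 * (12 * (v.2.2.1 * v.1) / v.2.2.2.1 +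
    v.2.2.1 * (8 * v.1 / v.2.2.2.2 + 2 * v.2.1)), ?_, ?_⟩
  · have hd1 : ContinuousOn (fun v : ℝ × ℝ × ℝ × ℝ × ℝ => 12 * (v.2.2.1 * v.1) / v.2.2.2.1)
        {v | 0 ≤ v.1 ∧ 0 ≤ v.2.1 ∧ 0 ≤ v.2.2.1 ∧ 0 < v.2.2.2.1 ∧ 0 < v.2.2.2.2} :=
      ContinuousOn.div (by fun_prop) (by fun_prop) fun v hv => hv.2.2.2.1.ne'
    have hd2 : ContinuousOn (fun v : ℝ × ℝ × ℝ × ℝ × ℝ => 8 * v.1 / v.2.2.2.2)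
        {v | 0 ≤ v.1 ∧ 0 ≤ v.2.1 ∧ 0 ≤ v.2.2.1 ∧ 0 < v.2.2.2.1 ∧ 0 < v.2.2.2.2} :=
      ContinuousOn.div (by fun_prop) (by fun_prop) fun v hv => hv.2.2.2.2.ne'
    fun_prop
  intro ι p Φ Ψ φ lam h
  obtain ⟨s₀, hs₀, hp⟩ := h.exists_tilt
  obtain ⟨τ, M, m, γ, T, B, hτ, hM, hm, hγ, hγ1, hadm⟩ := h.exists_admissible
  refine ⟨fun i => ?_, h.finitePart_univ_lt_top, h.exists_rate, ?_⟩
  · rw [h.acDensity_eq, h.finitePart_eq]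
    exact (hadm i).renewalMeasure_eq (hp i s₀ hs₀ le_rfl)
  intro z η hzm hη hLfin
  set L := (boundL z η).toReal with hLdef
  have hL : 0 ≤ L := ENNReal.toReal_nonneg
  have hz : ∀ i x, |z i x| ≤ L * Real.exp (-η * |x|) := fun i x => by
    have h1 : ENNReal.ofReal (Real.exp (η * |x|) * |z i x|) ≤ boundL z η :=
      le_iSup₂ (f := fun i x => ENNReal.ofReal (Real.exp (η * |x|) * |z i x|)) i x
    have h2 := (ENNReal.ofReal_le_iff_le_toReal hLfin.ne).1 h1
    rw [neg_mul, Real.exp_neg, ← div_eq_mul_inv, le_div_iff₀ (Real.exp_pos _), mul_comm]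
    exact h2
  have hsol : ∀ i, IsRenewalSolution (p i) (z i) (renewalSolution (p i) (z i)) := fun i =>
    have := h.prob_p i
    isRenewalSolution_renewalSolution (hzm i) hL (hz i) (min_le_left η s₀) (lt_min hη hs₀).le
      (hp i _ (lt_min hη hs₀) (min_le_right _ _))
  have hgrow : ∀ i, HasSubexpGrowth (renewalSolution (p i) (z i)) := fun i =>
    have := h.prob_p i
    hasSubexpGrowth_renewalSolution hL (hz i) hη hs₀ (hp i)
  refine ⟨fun i => ⟨renewalSolution (p i) (z i), ⟨hsol i, hgrow i⟩, fun Z hZ =>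
    hZ.1.eq_of_hasSubexpGrowth hZ.2 (hsol i) (hgrow i) hs₀ (hp i)⟩, fun Z hZ => ?_⟩
  have hZeq : ∀ i, Z i = renewalSolution (p i) (z i) := fun i =>
    (hZ i).1.eq_of_hasSubexpGrowth (hZ i).2 (hsol i) (hgrow i) hs₀ (hp i)
  refine ⟨fun i => ?_, fun r hr hA₁ hA₂ => ?_⟩
  · have := h.prob_p i
    rw [hZeq]
    exact measurable_renewalSolution (hzm i)
  set A := (boundA₁ p Ψ φ lam r).toReal with hAdef
  set A₂ := (boundA₂ Ψ lam r).toReal with hA₂def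
  have hA0 : 0 ≤ A := ENNReal.toReal_nonneg
  have hA₂0 : 0 ≤ A₂ := ENNReal.toReal_nonneg
  have key := fun i => (hadm i).abs_renewalSolution_sub_le hτ hm hγ1 hs₀ (hp i) hr (A := A)
    (A₂ := A₂) (fun x hx => by
      rw [← h.acDensity_eq]
      refine (ENNReal.ofReal_le_iff_le_toReal hA₁.ne).1 (le_trans ?_ le_self_add)
      exact le_iSup_of_le i (le_iSup₂_of_le x hx le_rfl))
    (fun x hx => by
      rw [← h.acDensity_eq]
      refine (ENNReal.ofReal_le_iff_le_toReal hA₁.ne).1 (le_trans ?_ le_add_self)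
      exact le_iSup_of_le i (le_iSup₂_of_le x hx le_rfl))
    hA₂0
    (fun x hx => by
      rw [hA₂def, ENNReal.ofReal_toReal hA₂.ne, ← h.finitePart_eq]
      exact le_iSup_of_le i (le_iSup₂_of_le x hx le_rfl))
    (hzm i) hL hη (hz i)
  simp only
  rw [two_mul, ENNReal.ofReal_add (by positivity) (by positivity)]
  refine add_le_add (iSup_le fun i => iSup_le fun x => iSup_le fun hx => ?_)
    (iSup_le fun i => iSup_le fun x => iSup_le fun hx => ?_)
  · rw [hZeq]
    exact ENNReal.ofReal_le_ofReal ((key i).1 x hx)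
  · rw [hZeq]
    exact ENNReal.ofReal_le_ofReal ((key i).2 x hx)
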